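/- All vector spaces and Lie algebras are over $\mathbb{C}$. A *standard pentad* $(\mathfrak g,\pi,U,\mathcal U,B)$ consists of a Lie algebra $\mathfrak g$, a representation $\pi$ of $\mathfrak g$ on $U$, a $\mathfrak g$-submodule $\mathcal U\subseteq \mathrm{Hom}(U,\mathbb C)$ and a non-degenerate invariant bilinear form $B$ on $\mathfrak g$ such that the canonical pairing $\langle\cdot,\cdot\rangle$ between $U$ and $\mathcal U$ is non-degenerate and there is a linear map $\Phi_\pi:U\otimes\mathcal U\to\mathfrak g$ with $B(a,\Phi_\pi(v\otimes\phi))=\langle \pi(a)v,\phi\rangle$ for all $a\in\mathfrak g$, $v\in U$, $\phi\in\mathcal U$. Its graded Lie algebra $L(\mathfrak g,\pi,U,\mathcal U,B)=\bigoplus_{n\in\mathbb Z}U_n$ is constructed as follows: $U_0=\mathfrak g$, $U_1=U$, $U_{-1}=\mathcal U$, with brackets $[a,v]=\pi(a)v$, $[a,\phi]=a\cdot\phi$, $[v,\phi]=\Phi_\pi(v\otimes\phi)$; for $n\ge 1$, $U_{n+1}\subseteq \mathrm{Hom}(U_{-1},U_n)$ is the image of the map $U_1\otimes U_n\to \mathrm{Hom}(U_{-1},U_n)$,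 $v\otimes u\mapsto\big(\phi\mapsto [[v,\phi],u]+[v,[u,\phi]]\big)$, and symmetrically $U_{-n-1}\subseteq\mathrm{Hom}(U_1,U_{-n})$ is the image of $U_{-1}\otimes U_{-n}$; here $[u,\phi]=u(\phi)$ for $u\in U_{n}$, $n\ge2$, $\phi\in U_{-1}$ (and similarly on the negative side), $v\otimes u$ is mapped to $[v,u]$, and the bracket is extended to all components inductively by the Jacobi identity. If $B$ is symmetric and $\mathfrak g$ is finite-dimensional, $\Gamma(\mathfrak g,B,\pi)$ denotes the local Lie algebra $U^*\oplus\mathfrak g\oplus U$ (degrees $-1,0,1$), in which $\mathfrak g$ acts on $U$ by $\pi$ and on $U^*=\mathrm{Hom}(U,\mathbb C)$ by the dual representation, and $[v,\phi]\in\mathfrak g$ is determined by $B([v,\phi],a)=\phi(\pi(a)v)$ for all $a\in\mathfrak g$. For a local Lie algebra $\Gamma$, $\mathfrak g_{max}(\Gamma)$ is the graded Lie algebra generated by $\Gamma$ subject to the relations of $\Gamma$, and $\mathfrak g_{min}(\Gamma)$ is the quotient of $\mathfrak g_{max}(\Gamma)$ by the sum of all graded ideals that meet its local part (the sum of the components of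 degrees $-1,0,1$) trivially. **Theorem.** Let $(\mathfrak g,\pi,U,U^*,B)$ be a standard pentad with $\mathfrak g$ and $U$ finite-dimensional and $B$ symmetric. Then $L(\mathfrak g,\pi,U,U^*,B)$ is isomorphic to $\mathfrak g_{min}(\Gamma(\mathfrak g,B,\pi))$ as a graded Lie algebra: there is an isomorphism of Lie algebras which maps the component of degree $n$ onto the component of degree $n$ for every $n\in\mathbb Z$. Moreover, $\mathfrak g_{min}(\Gamma(\mathfrak g,B,\pi))$ is the minimal graded Lie algebra with local part $\Gamma(\mathfrak g,B,\pi)$ in the sense of Kac: it is a graded Lie algebra generated by its local part, the canonical map from $\Gamma(\mathfrak g,B,\pi)$ is an isomorphism of local Lie algebras onto its local part, and for every graded Lie algebra $G'$ generated by its local part, every isomorphism from the local part of $G'$ onto that of $\mathfrak g_{min}(\Gamma(\mathfrak g,B,\pi))$ extends to an epimorphism of graded Lie algebras $G'\to\mathfrak g_{min}(\Gamma(\mathfrak g,B,\pi))$. -/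

import Mathlib

universe u v w

noncomputable section

namespace SasanoPentad

/-! ## Local Lie algebras -/

/-- A local Lie algebra `W ⊕ 𝔤 ⊕ V` with `W`, `𝔤`, `V` in degrees `-1`, `0`, `1`. The brackets
`𝔤 × 𝔤 → 𝔤`, `𝔤 × V → V` and `𝔤 × W → W` are the Lie bracket of `𝔤` and the given actions;
`bracket` is the remaining bracket `V × W → 𝔤`, and `lie_bracket` the remaining instance of the
Jacobi identity in which all brackets are defined. -/
structure LocalLieAlgebra (𝔤 : Type u) (V W : Type v) [LieRing 𝔤] [LieAlgebra ℂ 𝔤]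
    [AddCommGroup V] [Module ℂ V] [LieRingModule 𝔤 V] [LieModule ℂ 𝔤 V]
    [AddCommGroup W] [Module ℂ W] [LieRingModule 𝔤 W] [LieModule ℂ 𝔤 W] where
  bracket : V →ₗ[ℂ] W →ₗ[ℂ] 𝔤
  lie_bracket : ∀ (a : 𝔤) (x : V) (y : W),
    ⁅a, bracket x y⁆ = bracket ⁅a, x⁆ y + bracket x ⁅a, y⁆

/-- A bundled module over the Lie algebra `𝔤`. -/
structure LieMod (𝔤 : Type u) [LieRing 𝔤] [LieAlgebra ℂ 𝔤] : Type (max u (v + 1)) where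
  carrier : Type v
  [addCommGroup : AddCommGroup carrier]
  [module : Module ℂ carrier]
  [lieRingModule : LieRingModule 𝔤 carrier]
  [lieModule : LieModule ℂ 𝔤 carrier]

attribute [instance] LieMod.addCommGroup LieMod.module LieMod.lieRingModule LieMod.lieModule

section Tower

variable (𝔤 : Type u) (V W : Type v) [LieRing 𝔤] [LieAlgebra ℂ 𝔤]
  [AddCommGroup V] [Module ℂ V] [LieRingModule 𝔤 V] [LieModule ℂ 𝔤 V]
  [AddCommGroup W] [Module ℂ W] [LieRingModule 𝔤 W] [LieModule ℂ 𝔤 W]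

/-- The `𝔤`-modules `V`, `Hom(W, V)`, `Hom(W, Hom(W, V))`, … . -/
def tower : ℕ → LieMod.{u, v} 𝔤
  | 0 => ⟨V⟩
  | n + 1 => ⟨W →ₗ[ℂ] (tower n).carrier⟩

/-- The module underlying the `n`-th step `Hom(W, Hom(W, … Hom(W, V)))` (`n` times `W`). -/
abbrev Tower (n : ℕ) : Type v := (tower 𝔤 V W n).carrier

/-- The identification of an element of the `(n+1)`-st step with a linear map from `W` to the
`n`-th step. -/
def ev (n : ℕ) : Tower 𝔤 V W (n + 1) →ₗ[ℂ] W →ₗ[ℂ] Tower 𝔤 V W n :=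
  (LinearMap.id : (W →ₗ[ℂ] Tower 𝔤 V W n) →ₗ[ℂ] W →ₗ[ℂ] Tower 𝔤 V W n)

/-- The inverse of `ev`. -/
def unev (n : ℕ) : (W →ₗ[ℂ] Tower 𝔤 V W n) →ₗ[ℂ] Tower 𝔤 V W (n + 1) :=
  (LinearMap.id : (W →ₗ[ℂ] Tower 𝔤 V W n) →ₗ[ℂ] W →ₗ[ℂ] Tower 𝔤 V W n)

variable {𝔤 V W}

@[simp] lemma ev_unev (n : ℕ) (f : W →ₗ[ℂ] Tower 𝔤 V W n) : ev 𝔤 V W n (unev 𝔤 V W n f) = f := rfl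

lemma ev_lie (n : ℕ) (a : 𝔤) (x : Tower 𝔤 V W (n + 1)) (y : W) :
    ev 𝔤 V W n ⁅a, x⁆ y = ⁅a, ev 𝔤 V W n x y⁆ - ev 𝔤 V W n x ⁅a, y⁆ := rfl

lemma tower_ext (n : ℕ) {x x' : Tower 𝔤 V W (n + 1)}
    (h : ∀ y, ev 𝔤 V W n x y = ev 𝔤 V W n x' y) : x = x' :=
  LinearMap.ext (f := ev 𝔤 V W n x) (g := ev 𝔤 V W n x') h

end Tower

namespace LocalLieAlgebra

variable {𝔤 : Type u} {V W : Type v} [LieRing 𝔤] [LieAlgebra ℂ 𝔤]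
  [AddCommGroup V] [Module ℂ V] [LieRingModule 𝔤 V] [LieModule ℂ 𝔤 V]
  [AddCommGroup W] [Module ℂ W] [LieRingModule 𝔤 W] [LieModule ℂ 𝔤 W]

/-- The same local Lie algebra with the opposite grading. -/
def opp (Γ : LocalLieAlgebra 𝔤 V W) : LocalLieAlgebra 𝔤 W V where
  bracket := -Γ.bracket.flip
  lie_bracket a x y := by
    simp only [LinearMap.neg_apply, LinearMap.flip_apply, lie_neg, Γ.lie_bracket]
    abel

@[simp] lemma opp_bracket (Γ : LocalLieAlgebra 𝔤 V W) (x : V) (y : W) :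
    Γ.opp.bracket y x = -Γ.bracket x y := rfl

/-! ## The graded components constructed inductively -/

/-- The map `p_1 : V × V → Hom(W, V)`, `p_1(v, u)(y) = [v, y] · u - [u, y] · v`. -/
def raiseOne (Γ : LocalLieAlgebra 𝔤 V W) : V →ₗ[ℂ] V →ₗ[ℂ] W →ₗ[ℂ] V :=
  LinearMap.mk₂ ℂ
    (fun x u =>
      { toFun := fun y => ⁅Γ.bracket x y, u⁆ - ⁅Γ.bracket u y, x⁆
        map_add' := fun y y' => by simp only [map_add, add_lie]; abel
        map_smul' := fun c y => by simp [smul_sub] })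
    (fun x x' u => LinearMap.ext fun y => by
      simp only [map_add, LinearMap.add_apply, add_lie, lie_add, LinearMap.coe_mk, AddHom.coe_mk]
      abel)
    (fun c x u => LinearMap.ext fun y => by simp [smul_sub])
    (fun x u u' => LinearMap.ext fun y => by
      simp only [map_add, LinearMap.add_apply, add_lie, lie_add, LinearMap.coe_mk, AddHom.coe_mk]
      abel)
    (fun c x u => LinearMap.ext fun y => by simp [smul_sub])

/-- The maps `p_n : V × U_n → Hom(W, U_n)` (`n ≥ 1`), given by
`p_n(v, u)(y) = [v, y] · u + [v, [u, y]]`: here `[u, y] = u(y)` and `[v, ·] = p_{n-1}(v, ·)` if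
`n ≥ 2`, while for `n = 1` the second term is `[v, [u, y]] = -[u, y] · v`. (The index is shifted by
one: `Tower 𝔤 V W n` has degree `n + 1`.) -/
def raise (Γ : LocalLieAlgebra 𝔤 V W) :
    (n : ℕ) → V →ₗ[ℂ] Tower 𝔤 V W n →ₗ[ℂ] Tower 𝔤 V W (n + 1)
  | 0 => Γ.raiseOne
  | n + 1 => LinearMap.mk₂ ℂ
      (fun (x : V) (u : Tower 𝔤 V W (n + 1)) => unev 𝔤 V W (n + 1)
        { toFun := fun y => ⁅Γ.bracket x y, u⁆ + raise Γ n x (ev 𝔤 V W n u y)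
          map_add' := fun y y' => by simp only [map_add, add_lie]; abel
          map_smul' := fun c y => by simp [smul_add] })
      (fun x x' u => tower_ext (n + 1) fun y => by
        simp only [ev_unev, map_add, LinearMap.add_apply, add_lie, LinearMap.coe_mk,
          AddHom.coe_mk]; abel)
      (fun c x u => tower_ext (n + 1) fun y => by
        simp [smul_add])
      (fun x u u' => tower_ext (n + 1) fun y => by
        simp only [ev_unev, map_add, LinearMap.add_apply, lie_add, LinearMap.coe_mk,
          AddHom.coe_mk]; abel)
      (fun c x u => tower_ext (n + 1) fun y => by
        simp [smul_add])

lemma ev_raise_zero (Γ : LocalLieAlgebra 𝔤 V W) (x u : V) (y : W) :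
    ev 𝔤 V W 0 (Γ.raise 0 x u) y = (⁅Γ.bracket x y, u⁆ - ⁅Γ.bracket u y, x⁆ : V) := rfl

lemma ev_raise_succ (Γ : LocalLieAlgebra 𝔤 V W) (n : ℕ) (x : V) (u : Tower 𝔤 V W (n + 1)) (y : W) :
    ev 𝔤 V W (n + 1) (Γ.raise (n + 1) x u) y =
      ⁅Γ.bracket x y, u⁆ + Γ.raise n x (ev 𝔤 V W n u y) := rfl

lemma lie_raise (Γ : LocalLieAlgebra 𝔤 V W) (n : ℕ) (a : 𝔤) (x : V) (u : Tower 𝔤 V W n) :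
    ⁅a, Γ.raise n x u⁆ = Γ.raise n ⁅a, x⁆ u + Γ.raise n x ⁅a, u⁆ := by
  induction n with
  | zero =>
    refine tower_ext 0 fun y => ?_
    change V at u
    rw [ev_lie, map_add, LinearMap.add_apply]
    change ⁅a, (⁅Γ.bracket x y, u⁆ - ⁅Γ.bracket u y, x⁆ : V)⁆
      - (⁅Γ.bracket x ⁅a, y⁆, u⁆ - ⁅Γ.bracket u ⁅a, y⁆, x⁆ : V)
      = (⁅Γ.bracket ⁅a, x⁆ y, u⁆ - ⁅Γ.bracket u y, ⁅a, x⁆⁆ : V)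
      + (⁅Γ.bracket x y, ⁅a, u⁆⁆ - ⁅Γ.bracket ⁅a, u⁆ y, x⁆ : V)
    rw [lie_sub, leibniz_lie a (Γ.bracket x y), leibniz_lie a (Γ.bracket u y), Γ.lie_bracket,
      Γ.lie_bracket, add_lie, add_lie]
    abel
  | succ n ih =>
    refine tower_ext (n + 1) fun y => ?_
    rw [ev_lie, map_add, LinearMap.add_apply]
    simp only [ev_raise_succ]
    rw [lie_add, leibniz_lie a (Γ.bracket x y), Γ.lie_bracket, add_lie, ih, ev_lie, map_sub]
    abel

/-- The graded component of degree `n + 1`: degree `1` is `V`, and the component `U_{n+2}` is the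
image of `p_{n+1} : V ⊗ U_{n+1} → Hom(W, U_{n+1})`. -/
def component (Γ : LocalLieAlgebra 𝔤 V W) : (n : ℕ) → Submodule ℂ (Tower 𝔤 V W n)
  | 0 => ⊤
  | n + 1 => Submodule.span ℂ {z | ∃ x : V, ∃ u ∈ component Γ n, z = Γ.raise n x u}

/-- An ambient space for the direct sum of the components: the (full) product of
`… , Hom(V, W), W`, of `𝔤`, and of `V, Hom(W, V), …`. -/
abbrev Ambient (_Γ : LocalLieAlgebra 𝔤 V W) : Type (max u v) :=
  (∀ n, Tower 𝔤 W V n) × 𝔤 × (∀ n, Tower 𝔤 V W n)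

variable (Γ : LocalLieAlgebra 𝔤 V W)

/-- The inclusion of the step of degree `n + 1`. -/
def inPos (n : ℕ) : Tower 𝔤 V W n →ₗ[ℂ] Γ.Ambient :=
  LinearMap.inr ℂ (∀ n, Tower 𝔤 W V n) (𝔤 × ∀ n, Tower 𝔤 V W n) ∘ₗ
    LinearMap.inr ℂ 𝔤 (∀ n, Tower 𝔤 V W n) ∘ₗ LinearMap.single ℂ (fun n => Tower 𝔤 V W n) n

/-- The inclusion of the step of degree `-(n + 1)`. -/
def inNeg (n : ℕ) : Tower 𝔤 W V n →ₗ[ℂ] Γ.Ambient :=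
  LinearMap.inl ℂ (∀ n, Tower 𝔤 W V n) (𝔤 × ∀ n, Tower 𝔤 V W n) ∘ₗ
    LinearMap.single ℂ (fun n => Tower 𝔤 W V n) n

/-- The inclusion of degree `0`. -/
def inZero : 𝔤 →ₗ[ℂ] Γ.Ambient :=
  LinearMap.inr ℂ (∀ n, Tower 𝔤 W V n) (𝔤 × ∀ n, Tower 𝔤 V W n) ∘ₗ
    LinearMap.inl ℂ 𝔤 (∀ n, Tower 𝔤 V W n)

/-- The graded components `U_k`, `k ∈ ℤ`: `U_0 = 𝔤`, `U_1 = V`, `U_{n+1} ⊆ Hom(W, U_n)` the image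
of `V ⊗ U_n` for `n ≥ 1`, and symmetrically `U_{-1} = W`, `U_{-n-1} ⊆ Hom(V, U_{-n})`. -/
def piece : ℤ → Submodule ℂ Γ.Ambient
  | Int.ofNat 0 => LinearMap.range Γ.inZero
  | Int.ofNat (n + 1) => (Γ.component n).map (Γ.inPos n)
  | Int.negSucc n => (Γ.opp.component n).map (Γ.inNeg n)

/-- The space `⨁ U_k`, as the (internal) direct sum of the components. -/
def total : Submodule ℂ Γ.Ambient := ⨆ k, Γ.piece k

/-- The operator `[x, ·]` for `x ∈ V`: it is `p_n(x, ·)` in degrees `n ≥ 1`, it sends `a ∈ 𝔤` to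
`-a · x`, it sends `y ∈ W` to `[x, y]`, and `z ∈ U_{-n-1} ⊆ Hom(V, U_{-n})` to `-z(x)`. -/
def opV (x : V) : Γ.Ambient →ₗ[ℂ] Γ.Ambient where
  toFun z :=
    (fun n => -ev 𝔤 W V n (z.1 (n + 1)) x,
     Γ.bracket x (z.1 0),
     fun n => match n with
      | 0 => (-⁅z.2.1, x⁆ : V)
      | n + 1 => Γ.raise n x (z.2.2 n))
  map_add' z z' := by
    refine Prod.ext ?_ (Prod.ext ?_ ?_)
    · funext n
      simp only [Prod.fst_add, Pi.add_apply, map_add, LinearMap.add_apply, neg_add]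
    · exact (Γ.bracket x).map_add (z.1 0) (z'.1 0)
    · funext n
      cases n with
      | zero =>
        change (-⁅z.2.1 + z'.2.1, x⁆ : V) = -⁅z.2.1, x⁆ + -⁅z'.2.1, x⁆
        rw [add_lie, neg_add]
      | succ n => exact (Γ.raise n x).map_add (z.2.2 n) (z'.2.2 n)
  map_smul' c z := by
    refine Prod.ext ?_ (Prod.ext ?_ ?_)
    · funext n
      simp only [Prod.smul_fst, Pi.smul_apply, map_smul, LinearMap.smul_apply, smul_neg,
        RingHom.id_apply]
    · exact (Γ.bracket x).map_smul c (z.1 0)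
    · funext n
      cases n with
      | zero =>
        change (-⁅c • z.2.1, x⁆ : V) = c • -⁅z.2.1, x⁆
        rw [smul_lie, smul_neg]
      | succ n => exact (Γ.raise n x).map_smul c (z.2.2 n)

/-- The operator `[y, ·]` for `y ∈ W`. -/
def opW (y : W) : Γ.Ambient →ₗ[ℂ] Γ.Ambient where
  toFun z :=
    (fun n => match n with
      | 0 => (-⁅z.2.1, y⁆ : W)
      | n + 1 => Γ.opp.raise n y (z.1 n),
     Γ.opp.bracket y (z.2.2 0),
     fun n => -ev 𝔤 V W n (z.2.2 (n + 1)) y)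
  map_add' z z' := by
    refine Prod.ext ?_ (Prod.ext ?_ ?_)
    · funext n
      cases n with
      | zero =>
        change (-⁅z.2.1 + z'.2.1, y⁆ : W) = -⁅z.2.1, y⁆ + -⁅z'.2.1, y⁆
        rw [add_lie, neg_add]
      | succ n => exact (Γ.opp.raise n y).map_add (z.1 n) (z'.1 n)
    · exact (Γ.opp.bracket y).map_add (z.2.2 0) (z'.2.2 0)
    · funext n
      simp only [Prod.snd_add, Pi.add_apply, map_add, LinearMap.add_apply, neg_add]
  map_smul' c z := by
    refine Prod.ext ?_ (Prod.ext ?_ ?_)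
    · funext n
      cases n with
      | zero =>
        change (-⁅c • z.2.1, y⁆ : W) = c • -⁅z.2.1, y⁆
        rw [smul_lie, smul_neg]
      | succ n => exact (Γ.opp.raise n y).map_smul c (z.1 n)
    · exact (Γ.opp.bracket y).map_smul c (z.2.2 0)
    · funext n
      simp only [Prod.smul_snd, Pi.smul_apply, map_smul, LinearMap.smul_apply, smul_neg,
        RingHom.id_apply]

/-- The operator `[a, ·]` for `a ∈ 𝔤`. -/
def opZero (a : 𝔤) : Γ.Ambient →ₗ[ℂ] Γ.Ambient where
  toFun z := (fun n => ⁅a, z.1 n⁆, ⁅a, z.2.1⁆, fun n => ⁅a, z.2.2 n⁆)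
  map_add' z z' := by
    refine Prod.ext ?_ (Prod.ext ?_ ?_)
    · funext n; simp
    · simp
    · funext n; simp
  map_smul' c z := by
    refine Prod.ext ?_ (Prod.ext ?_ ?_)
    · funext n; simp
    · simp
    · funext n; simp

lemma opV_fst (x : V) (z : Γ.Ambient) (n : ℕ) :
    (Γ.opV x z).1 n = -ev 𝔤 W V n (z.1 (n + 1)) x := rfl
lemma opV_mid (x : V) (z : Γ.Ambient) : (Γ.opV x z).2.1 = Γ.bracket x (z.1 0) := rfl
lemma opV_zero (x : V) (z : Γ.Ambient) : (Γ.opV x z).2.2 0 = (-⁅z.2.1, x⁆ : V) := rfl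
lemma opV_succ (x : V) (z : Γ.Ambient) (n : ℕ) :
    (Γ.opV x z).2.2 (n + 1) = Γ.raise n x (z.2.2 n) := rfl
lemma opW_snd (y : W) (z : Γ.Ambient) (n : ℕ) :
    (Γ.opW y z).2.2 n = -ev 𝔤 V W n (z.2.2 (n + 1)) y := rfl
lemma opW_mid (y : W) (z : Γ.Ambient) : (Γ.opW y z).2.1 = -Γ.bracket (z.2.2 0) y := rfl
lemma opW_zero (y : W) (z : Γ.Ambient) : (Γ.opW y z).1 0 = (-⁅z.2.1, y⁆ : W) := rfl
lemma opW_succ (y : W) (z : Γ.Ambient) (n : ℕ) :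
    (Γ.opW y z).1 (n + 1) = Γ.opp.raise n y (z.1 n) := rfl
lemma opZero_fst (a : 𝔤) (z : Γ.Ambient) (n : ℕ) : (Γ.opZero a z).1 n = ⁅a, z.1 n⁆ := rfl
lemma opZero_mid (a : 𝔤) (z : Γ.Ambient) : (Γ.opZero a z).2.1 = ⁅a, z.2.1⁆ := rfl
lemma opZero_snd (a : 𝔤) (z : Γ.Ambient) (n : ℕ) : (Γ.opZero a z).2.2 n = ⁅a, z.2.2 n⁆ := rfl

lemma opZero_opV (a : 𝔤) (x : V) (z : Γ.Ambient) :
    Γ.opZero a (Γ.opV x z) = Γ.opV ⁅a, x⁆ z + Γ.opV x (Γ.opZero a z) := by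
  refine Prod.ext ?_ (Prod.ext ?_ ?_)
  · funext n
    simp only [Prod.fst_add, Pi.add_apply, opZero_fst, opV_fst, ev_lie, lie_neg]
    abel
  · exact Γ.lie_bracket a x (z.1 0)
  · funext n
    cases n with
    | zero =>
      change ⁅a, (-⁅z.2.1, x⁆ : V)⁆ = -⁅z.2.1, ⁅a, x⁆⁆ + -⁅⁅a, z.2.1⁆, x⁆
      rw [lie_neg, leibniz_lie]; abel
    | succ n => exact Γ.lie_raise n a x (z.2.2 n)

lemma opZero_opW (a : 𝔤) (y : W) (z : Γ.Ambient) :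
    Γ.opZero a (Γ.opW y z) = Γ.opW ⁅a, y⁆ z + Γ.opW y (Γ.opZero a z) := by
  refine Prod.ext ?_ (Prod.ext ?_ ?_)
  · funext n
    cases n with
    | zero =>
      change ⁅a, (-⁅z.2.1, y⁆ : W)⁆ = -⁅z.2.1, ⁅a, y⁆⁆ + -⁅⁅a, z.2.1⁆, y⁆
      rw [lie_neg, leibniz_lie]; abel
    | succ n => exact Γ.opp.lie_raise n a y (z.1 n)
  · exact Γ.opp.lie_bracket a y (z.2.2 0)
  · funext n
    simp only [Prod.snd_add, Pi.add_apply, opZero_snd, opW_snd, ev_lie, lie_neg]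
    abel

lemma opZero_opZero (a b : 𝔤) (z : Γ.Ambient) :
    Γ.opZero a (Γ.opZero b z) = Γ.opZero ⁅a, b⁆ z + Γ.opZero b (Γ.opZero a z) := by
  refine Prod.ext ?_ (Prod.ext ?_ ?_)
  · funext n; exact leibniz_lie a b (z.1 n)
  · exact leibniz_lie a b z.2.1
  · funext n; exact leibniz_lie a b (z.2.2 n)

lemma opV_opW (x : V) (y : W) (z : Γ.Ambient) :
    Γ.opV x (Γ.opW y z) = Γ.opZero (Γ.bracket x y) z + Γ.opW y (Γ.opV x z) := by
  refine Prod.ext ?_ (Prod.ext ?_ ?_)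
  · funext n
    cases n with
    | zero =>
      have key : ∀ u : W, (-(⁅Γ.opp.bracket y x, u⁆ - ⁅Γ.opp.bracket u x, y⁆) : W) =
          ⁅Γ.bracket x y, u⁆ + -⁅Γ.bracket x u, y⁆ := fun u => by
        simp only [opp_bracket, neg_lie]; abel
      exact key (z.1 0)
    | succ n =>
      simp only [Prod.fst_add, Pi.add_apply, opZero_fst, opV_fst, opW_succ, ev_raise_succ,
        opp_bracket, neg_lie, map_neg]
      abel
  · change Γ.bracket x (-⁅z.2.1, y⁆ : W) = ⁅Γ.bracket x y, z.2.1⁆ + -Γ.bracket (-⁅z.2.1, x⁆) y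
    rw [← lie_skew, Γ.lie_bracket, map_neg, map_neg, LinearMap.neg_apply]; abel
  · funext n
    cases n with
    | zero =>
      have key : ∀ u : V, (-⁅-Γ.bracket u y, x⁆ : V) =
          ⁅Γ.bracket x y, u⁆ + -(⁅Γ.bracket x y, u⁆ - ⁅Γ.bracket u y, x⁆) := fun u => by
        rw [neg_lie]; abel
      exact key (z.2.2 0)
    | succ n =>
      simp only [Prod.snd_add, Pi.add_apply, opZero_snd, opV_succ, opW_snd, ev_raise_succ, map_neg]
      abel

/-! ## The Lie bracket -/

section Commutator

variable {A : Type w} [AddCommGroup A] [Module ℂ A]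

/-- The commutator of two linear operators. -/
def comm (D D' : A →ₗ[ℂ] A) : A →ₗ[ℂ] A := D ∘ₗ D' - D' ∘ₗ D

@[simp] lemma comm_apply (D D' : A →ₗ[ℂ] A) (z : A) : comm D D' z = D (D' z) - D' (D z) := rfl

/-- Auxiliary: a representation of a local Lie algebra on a vector space which contains it, with
subspaces `E n` (of degree `n + 1`) on which the action of `W` is faithful. -/
structure LocalAction (Γ : LocalLieAlgebra 𝔤 V W) (A : Type w) [AddCommGroup A] [Module ℂ A] where
  dV : V → A →ₗ[ℂ] A
  d0 : 𝔤 → A →ₗ[ℂ] A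
  dW : W → A →ₗ[ℂ] A
  iV : V → A
  i0 : 𝔤 → A
  iW : W → A
  E : ℕ → Submodule ℂ A
  d0_add : ∀ a b, d0 (a + b) = d0 a + d0 b
  d0_smul : ∀ (c : ℂ) a, d0 (c • a) = c • d0 a
  i0_add : ∀ a b, i0 (a + b) = i0 a + i0 b
  i0_smul : ∀ (c : ℂ) a, i0 (c • a) = c • i0 a
  d0_dV : ∀ a x z, d0 a (dV x z) = dV ⁅a, x⁆ z + dV x (d0 a z)
  d0_dW : ∀ a y z, d0 a (dW y z) = dW ⁅a, y⁆ z + dW y (d0 a z)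
  dV_dW : ∀ x y z, dV x (dW y z) = d0 (Γ.bracket x y) z + dW y (dV x z)
  dV_i0 : ∀ x a, dV x (i0 a) = -iV ⁅a, x⁆
  d0_iV : ∀ a x, d0 a (iV x) = iV ⁅a, x⁆
  dW_i0 : ∀ y a, dW y (i0 a) = -iW ⁅a, y⁆
  dV_iW : ∀ x y, dV x (iW y) = i0 (Γ.bracket x y)
  dW_iV : ∀ y x, dW y (iV x) = -i0 (Γ.bracket x y)
  iV_mem : ∀ x, iV x ∈ E 0
  dV_mem : ∀ n x z, z ∈ E n → dV x z ∈ E (n + 1)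
  d0_mem : ∀ n a z, z ∈ E n → d0 a z ∈ E n
  faithful : ∀ n z, z ∈ E (n + 1) → (∀ y, dW y z = 0) → z = 0

namespace LocalAction

variable {Γ : LocalLieAlgebra 𝔤 V W} (α : LocalAction Γ A)

/-- Auxiliary: the pairs `(ad z, z)` with `z` of degree `n + 1`. -/
inductive Pair : ℕ → (A →ₗ[ℂ] A) → A → Prop
  | base (x) : Pair 0 (α.dV x) (α.iV x)
  | step {n D z} (x) : Pair n D z → Pair (n + 1) (comm (α.dV x) D) (α.dV x z)
  | add {n D z D' z'} : Pair n D z → Pair n D' z' → Pair n (D + D') (z + z')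
  | smul {n D z} (c : ℂ) : Pair n D z → Pair n (c • D) (c • z)

variable {α}

lemma comm_add_right (D D₁ D₂ : A →ₗ[ℂ] A) : comm D (D₁ + D₂) = comm D D₁ + comm D D₂ := by
  ext z; simp; abel

lemma comm_smul_right (D D₁ : A →ₗ[ℂ] A) (c : ℂ) : comm D (c • D₁) = c • comm D D₁ := by
  ext z; simp [smul_sub]

lemma Pair.d0 {n D z} (h : α.Pair n D z) (a : 𝔤) : α.Pair n (comm (α.d0 a) D) (α.d0 a z) := by
  induction h with
  | base x =>
    have : comm (α.d0 a) (α.dV x) = α.dV ⁅a, x⁆ := by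
      ext z; simp [α.d0_dV]
    rw [this, α.d0_iV]; exact .base _
  | @step n D z x h ih =>
    have : comm (α.d0 a) (comm (α.dV x) D) =
        comm (α.dV ⁅a, x⁆) D + comm (α.dV x) (comm (α.d0 a) D) := by
      ext z; simp [α.d0_dV]; abel
    rw [this, α.d0_dV]; exact .add (.step _ h) (.step _ ih)
  | add _ _ ih ih' => rw [comm_add_right, map_add]; exact .add ih ih'
  | smul c _ ih => rw [comm_smul_right, map_smul]; exact .smul c ih

lemma Pair.dW {n D z} (h : α.Pair n D z) (y : W) :
    (n = 0 → ∃ a, comm (α.dW y) D = α.d0 a ∧ α.dW y z = α.i0 a) ∧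
      ∀ m, n = m + 1 → α.Pair m (comm (α.dW y) D) (α.dW y z) := by
  induction h with
  | base x =>
    refine ⟨fun _ => ⟨(-1 : ℂ) • Γ.bracket x y, ?_, ?_⟩, fun m hm => by omega⟩
    · rw [α.d0_smul]; ext z; simp [α.dV_dW]
    · rw [α.dW_iV, α.i0_smul]; simp
  | @step n D z x h ih =>
    refine ⟨fun hn => by omega, fun m hm => ?_⟩
    obtain rfl : n = m := by omega
    have e : comm (α.dW y) (comm (α.dV x) D) =
        (-1 : ℂ) • comm (α.d0 (Γ.bracket x y)) D + comm (α.dV x) (comm (α.dW y) D) := by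
      ext z; simp [α.dV_dW]; abel
    have e' : α.dW y (α.dV x z) =
        (-1 : ℂ) • α.d0 (Γ.bracket x y) z + α.dV x (α.dW y z) := by
      simp [α.dV_dW]
    rw [e, e']
    refine .add (.smul _ (h.d0 _)) ?_
    cases n with
    | zero =>
      obtain ⟨a, ha, ha'⟩ := ih.1 rfl
      rw [ha, ha', α.dV_i0]
      have e'' : comm (α.dV x) (α.d0 a) = (-1 : ℂ) • α.dV ⁅a, x⁆ := by
        ext z; simp [α.d0_dV]
      rw [e'', ← neg_one_smul ℂ (α.iV _)]
      exact .smul _ (.base _)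
    | succ n => exact .step _ (ih.2 n rfl)
  | @add n D z D' z' _ _ ih ih' =>
    rw [comm_add_right, map_add]
    refine ⟨fun hn => ?_, fun m hm => .add (ih.2 m hm) (ih'.2 m hm)⟩
    obtain ⟨a, h1, h2⟩ := ih.1 hn
    obtain ⟨b, h3, h4⟩ := ih'.1 hn
    exact ⟨a + b, by rw [h1, h3, α.d0_add], by rw [h2, h4, α.i0_add]⟩
  | smul c _ ih =>
    rw [comm_smul_right, map_smul]
    refine ⟨fun hn => ?_, fun m hm => .smul c (ih.2 m hm)⟩
    obtain ⟨a, h1, h2⟩ := ih.1 hn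
    exact ⟨c • a, by rw [h1, α.d0_smul], by rw [h2, α.i0_smul]⟩

lemma Pair.mem {n D z} (h : α.Pair n D z) :
    z ∈ α.E n ∧ (∀ a, D (α.i0 a) ∈ α.E n) ∧ ∀ k u, u ∈ α.E k → D u ∈ α.E (n + k + 1) := by
  induction h with
  | base x =>
    refine ⟨α.iV_mem x, fun a => ?_, fun k u hu => ?_⟩
    · rw [α.dV_i0]; exact neg_mem (α.iV_mem _)
    · rw [zero_add]; exact α.dV_mem _ _ _ hu
  | @step n D z x h ih =>
    obtain ⟨h1, h2, h3⟩ := ih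
    refine ⟨α.dV_mem _ _ _ h1, fun a => ?_, fun k u hu => ?_⟩
    · rw [comm_apply]
      refine sub_mem (α.dV_mem _ _ _ (h2 a)) ?_
      rw [α.dV_i0, map_neg]
      exact neg_mem (h3 0 _ (α.iV_mem _))
    · rw [comm_apply]
      refine sub_mem ?_ ?_
      · have := α.dV_mem _ x _ (h3 k u hu)
        rwa [show n + 1 + k + 1 = n + k + 1 + 1 by omega]
      · have := h3 (k + 1) _ (α.dV_mem _ x _ hu)
        rwa [show n + 1 + k + 1 = n + (k + 1) + 1 by omega]
  | add _ _ ih ih' =>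
    exact ⟨add_mem ih.1 ih'.1, fun a => add_mem (ih.2.1 a) (ih'.2.1 a),
      fun k u hu => add_mem (ih.2.2 k u hu) (ih'.2.2 k u hu)⟩
  | smul c _ ih =>
    exact ⟨Submodule.smul_mem _ c ih.1, fun a => Submodule.smul_mem _ c (ih.2.1 a),
      fun k u hu => Submodule.smul_mem _ c (ih.2.2 k u hu)⟩

lemma Pair.skewW {n D z} (h : α.Pair n D z)
    (H : ∀ m < n, ∀ D z, α.Pair m D z → (∀ y, D (α.iW y) + α.dW y z = 0) ∧
      ∀ a, D (α.i0 a) + α.d0 a z = 0) (y : W) :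
    D (α.iW y) + α.dW y z = 0 := by
  induction h with
  | base x => rw [α.dV_iW, α.dW_iV]; abel
  | @step n D z x h _ =>
    obtain ⟨h1, h2⟩ := H n (by omega) D z h
    have e1 := congrArg (α.dV x) (h1 y)
    have e2 := h2 (Γ.bracket x y)
    rw [map_add, map_zero, α.dV_dW] at e1
    rw [comm_apply, α.dV_iW]
    have : α.dV x (D (α.iW y)) - D (α.i0 (Γ.bracket x y)) + α.dW y (α.dV x z) =
      (α.dV x (D (α.iW y)) + (α.d0 (Γ.bracket x y) z + α.dW y (α.dV x z))) -
        (D (α.i0 (Γ.bracket x y)) + α.d0 (Γ.bracket x y) z) := by abel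
    rw [this, e1, e2, sub_zero]
  | @add n D z D' z' _ _ ih ih' =>
    have : (D + D') (α.iW y) + α.dW y (z + z') =
        (D (α.iW y) + α.dW y z) + (D' (α.iW y) + α.dW y z') := by
      simp only [map_add, LinearMap.add_apply]; abel
    rw [this, ih H, ih' H, add_zero]
  | smul c _ ih =>
    rw [map_smul, LinearMap.smul_apply, ← smul_add, ih H, smul_zero]

lemma Pair.skew_zero {n D z} (h : α.Pair n D z) (hn : n = 0) :
    (∀ a, D (α.i0 a) + α.d0 a z = 0) ∧ ∀ x, D (α.iV x) + α.dV x z = 0 := by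
  induction h with
  | base x =>
    refine ⟨fun a => by rw [α.dV_i0, α.d0_iV]; abel, fun x' => ?_⟩
    refine α.faithful 0 _
      (add_mem (α.dV_mem _ _ _ (α.iV_mem _)) (α.dV_mem _ _ _ (α.iV_mem _))) fun y => ?_
    have key : ∀ x x', α.dW y (α.dV x (α.iV x')) =
        α.iV ⁅Γ.bracket x' y, x⁆ - α.iV ⁅Γ.bracket x y, x'⁆ := fun x x' => by
      have := α.dV_dW x y (α.iV x')
      rw [α.dW_iV, map_neg, α.dV_i0, neg_neg, α.d0_iV] at this
      rw [this]; abel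
    rw [map_add, key, key]; abel
  | step => omega
  | @add n D z D' z' _ _ ih ih' =>
    refine ⟨fun y => ?_, fun y => ?_⟩
    · have : (D + D') (α.i0 y) + α.d0 y (z + z') =
          (D (α.i0 y) + α.d0 y z) + (D' (α.i0 y) + α.d0 y z') := by
        simp only [map_add, LinearMap.add_apply]; abel
      rw [this, (ih hn).1, (ih' hn).1, add_zero]
    · have : (D + D') (α.iV y) + α.dV y (z + z') =
          (D (α.iV y) + α.dV y z) + (D' (α.iV y) + α.dV y z') := by
        simp only [map_add, LinearMap.add_apply]; abel
      rw [this, (ih hn).2, (ih' hn).2, add_zero]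
  | smul c _ ih =>
    refine ⟨fun y => ?_, fun y => ?_⟩
    · rw [map_smul, LinearMap.smul_apply, ← smul_add, (ih hn).1, smul_zero]
    · rw [map_smul, LinearMap.smul_apply, ← smul_add, (ih hn).2, smul_zero]

lemma Pair.skew (n : ℕ) : ∀ D z, α.Pair n D z → (∀ y, D (α.iW y) + α.dW y z = 0) ∧
    (∀ a, D (α.i0 a) + α.d0 a z = 0) ∧ ∀ x, D (α.iV x) + α.dV x z = 0 := by
  induction n using Nat.strong_induction_on with
  | _ n ih =>
  intro D z h
  have hW : ∀ y, D (α.iW y) + α.dW y z = 0 :=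
    h.skewW fun m hm D z h => ⟨(ih m hm D z h).1, (ih m hm D z h).2.1⟩
  refine ⟨hW, ?_⟩
  cases n with
  | zero => exact h.skew_zero rfl
  | succ n =>
    obtain ⟨m1, m2, m3⟩ := h.mem
    have h0 : ∀ a, D (α.i0 a) + α.d0 a z = 0 := fun a => by
      refine α.faithful n _ (add_mem (m2 a) (α.d0_mem _ _ _ m1)) fun y => ?_
      have e1 := (ih n (by omega) _ _ ((h.dW y).2 n rfl)).2.1 a
      have e2 := hW ⁅a, y⁆
      rw [comm_apply, α.dW_i0, map_neg, α.d0_dW] at e1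
      have : α.dW y (D (α.i0 a) + α.d0 a z) =
        (α.dW y (D (α.i0 a)) - -D (α.iW ⁅a, y⁆) + (α.dW ⁅a, y⁆ z + α.dW y (α.d0 a z))) -
          (D (α.iW ⁅a, y⁆) + α.dW ⁅a, y⁆ z) := by rw [map_add]; abel
      rw [this, e1, e2, sub_zero]
    refine ⟨h0, fun x => ?_⟩
    refine α.faithful (n + 1) _ (add_mem (m3 0 _ (α.iV_mem x)) (α.dV_mem _ _ _ m1)) fun y => ?_
    have e1 := (ih n (by omega) _ _ ((h.dW y).2 n rfl)).2.2 x
    have e2 := h0 (Γ.bracket x y)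
    rw [comm_apply, α.dW_iV, map_neg, α.dV_dW] at e1
    have : α.dW y (D (α.iV x) + α.dV x z) =
      (α.dW y (D (α.iV x)) - -D (α.i0 (Γ.bracket x y)) +
        (α.d0 (Γ.bracket x y) z + α.dW y (α.dV x z))) -
        (D (α.i0 (Γ.bracket x y)) + α.d0 (Γ.bracket x y) z) := by rw [map_add]; abel
    rw [this, e1, e2, sub_zero]

end LocalAction

end Commutator

@[simp] lemma inPos_fst (n : ℕ) (u : Tower 𝔤 V W n) : (Γ.inPos n u).1 = 0 := rfl
@[simp] lemma inPos_mid (n : ℕ) (u : Tower 𝔤 V W n) : (Γ.inPos n u).2.1 = 0 := rfl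
@[simp] lemma inPos_snd (n : ℕ) (u : Tower 𝔤 V W n) : (Γ.inPos n u).2.2 = Pi.single n u := rfl
@[simp] lemma inNeg_fst (n : ℕ) (u : Tower 𝔤 W V n) : (Γ.inNeg n u).1 = Pi.single n u := rfl
@[simp] lemma inNeg_snd (n : ℕ) (u : Tower 𝔤 W V n) : (Γ.inNeg n u).2 = 0 := rfl
@[simp] lemma inZero_fst (a : 𝔤) : (Γ.inZero a).1 = 0 := rfl
@[simp] lemma inZero_snd (a : 𝔤) : (Γ.inZero a).2 = (a, 0) := rfl

/-- The inclusion of `V`, in degree `1`. -/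
def inV : V →ₗ[ℂ] Γ.Ambient := Γ.inPos 0

/-- The inclusion of `W`, in degree `-1`. -/
def inW : W →ₗ[ℂ] Γ.Ambient := Γ.inNeg 0

@[simp] lemma inV_fst (x : V) : (Γ.inV x).1 = 0 := rfl
@[simp] lemma inV_mid (x : V) : (Γ.inV x).2.1 = 0 := rfl
@[simp] lemma inV_succ (x : V) (n : ℕ) : (Γ.inV x).2.2 (n + 1) = 0 := rfl
@[simp] lemma inW_snd (y : W) : (Γ.inW y).2 = 0 := rfl
@[simp] lemma inW_succ (y : W) (n : ℕ) : (Γ.inW y).1 (n + 1) = 0 := rfl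

lemma opV_inPos (x : V) (n : ℕ) (u : Tower 𝔤 V W n) :
    Γ.opV x (Γ.inPos n u) = Γ.inPos (n + 1) (Γ.raise n x u) := by
  refine Prod.ext ?_ (Prod.ext ?_ ?_)
  · funext m; rw [opV_fst]; simp
  · exact (Γ.bracket x).map_zero
  · funext m
    cases m with
    | zero => exact (congrArg Neg.neg (zero_lie x)).trans neg_zero
    | succ m =>
      rw [opV_succ]
      by_cases h : m = n
      · subst h; simp
      · simp [Pi.single_eq_of_ne, h]

lemma opW_inNeg (y : W) (n : ℕ) (u : Tower 𝔤 W V n) :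
    Γ.opW y (Γ.inNeg n u) = Γ.inNeg (n + 1) (Γ.opp.raise n y u) := by
  refine Prod.ext ?_ (Prod.ext ?_ ?_)
  · funext m
    cases m with
    | zero => exact (congrArg Neg.neg (zero_lie y)).trans neg_zero
    | succ m =>
      rw [opW_succ]
      by_cases h : m = n
      · subst h; simp
      · simp [Pi.single_eq_of_ne, h]
  · exact (Γ.opp.bracket y).map_zero
  · funext m; rw [opW_snd]; simp

lemma opZero_inPos (a : 𝔤) (n : ℕ) (u : Tower 𝔤 V W n) :
    Γ.opZero a (Γ.inPos n u) = Γ.inPos n ⁅a, u⁆ := by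
  refine Prod.ext ?_ (Prod.ext ?_ ?_)
  · funext m; rw [opZero_fst]; simp
  · rw [opZero_mid]; simp
  · funext m
    rw [opZero_snd]
    by_cases h : m = n
    · subst h; simp
    · simp [Pi.single_eq_of_ne, h]

lemma opZero_inNeg (a : 𝔤) (n : ℕ) (u : Tower 𝔤 W V n) :
    Γ.opZero a (Γ.inNeg n u) = Γ.inNeg n ⁅a, u⁆ := by
  refine Prod.ext ?_ (Prod.ext ?_ ?_)
  · funext m
    rw [opZero_fst]
    by_cases h : m = n
    · subst h; simp
    · simp [Pi.single_eq_of_ne, h]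
  · rw [opZero_mid]; simp
  · funext m; rw [opZero_snd]; simp

lemma opZero_inV (a : 𝔤) (x : V) : Γ.opZero a (Γ.inV x) = Γ.inV ⁅a, x⁆ := Γ.opZero_inPos a 0 x

lemma opZero_inW (a : 𝔤) (y : W) : Γ.opZero a (Γ.inW y) = Γ.inW ⁅a, y⁆ := Γ.opZero_inNeg a 0 y

lemma opZero_inZero (a b : 𝔤) : Γ.opZero a (Γ.inZero b) = Γ.inZero ⁅a, b⁆ := by
  refine Prod.ext ?_ (Prod.ext ?_ ?_)
  · funext m; rw [opZero_fst]; simp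
  · rw [opZero_mid]; simp
  · funext m; rw [opZero_snd]; simp

lemma opV_inZero (x : V) (a : 𝔤) : Γ.opV x (Γ.inZero a) = -Γ.inV ⁅a, x⁆ := by
  refine Prod.ext ?_ (Prod.ext ?_ ?_)
  · funext m; rw [opV_fst]; simp
  · exact (Γ.bracket x).map_zero.trans neg_zero.symm
  · funext m
    cases m with
    | zero => rfl
    | succ m => rw [opV_succ]; simp

lemma opW_inZero (y : W) (a : 𝔤) : Γ.opW y (Γ.inZero a) = -Γ.inW ⁅a, y⁆ := by
  refine Prod.ext ?_ (Prod.ext ?_ ?_)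
  · funext m
    cases m with
    | zero => rfl
    | succ m => rw [opW_succ]; simp
  · exact (Γ.opp.bracket y).map_zero.trans neg_zero.symm
  · funext m; rw [opW_snd]; simp

lemma opV_inW (x : V) (y : W) : Γ.opV x (Γ.inW y) = Γ.inZero (Γ.bracket x y) := by
  refine Prod.ext ?_ (Prod.ext ?_ ?_)
  · funext m; rw [opV_fst]; simp
  · rfl
  · funext m
    cases m with
    | zero => exact (congrArg Neg.neg (zero_lie x)).trans neg_zero
    | succ m => rw [opV_succ]; simp

lemma opW_inV (y : W) (x : V) : Γ.opW y (Γ.inV x) = -Γ.inZero (Γ.bracket x y) := by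
  refine Prod.ext ?_ (Prod.ext ?_ ?_)
  · funext m
    cases m with
    | zero => exact (congrArg Neg.neg (zero_lie y)).trans (neg_zero.trans neg_zero.symm)
    | succ m => rw [opW_succ]; simp
  · rfl
  · funext m; rw [opW_snd]; simp

lemma opW_inPos_succ (y : W) (n : ℕ) (u : Tower 𝔤 V W (n + 1)) :
    (Γ.opW y (Γ.inPos (n + 1) u)).2.2 n = -ev 𝔤 V W n u y := by
  rw [opW_snd]; simp

lemma opV_inNeg_succ (x : V) (n : ℕ) (u : Tower 𝔤 W V (n + 1)) :
    (Γ.opV x (Γ.inNeg (n + 1) u)).1 n = -ev 𝔤 W V n u x := by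
  rw [opV_fst]; simp

lemma opZero_add (a b : 𝔤) : Γ.opZero (a + b) = Γ.opZero a + Γ.opZero b := by
  refine LinearMap.ext fun z => Prod.ext ?_ (Prod.ext ?_ ?_)
  · funext m; exact add_lie _ _ _
  · exact add_lie _ _ _
  · funext m; exact add_lie _ _ _

lemma opZero_smul (c : ℂ) (a : 𝔤) : Γ.opZero (c • a) = c • Γ.opZero a := by
  refine LinearMap.ext fun z => Prod.ext ?_ (Prod.ext ?_ ?_)
  · funext m; exact smul_lie _ _ _
  · exact smul_lie _ _ _
  · funext m; exact smul_lie _ _ _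

/-- Auxiliary: the operators `[x, ·]`, `[a, ·]`, `[y, ·]`, seen from the positive side. -/
def posAction : LocalAction Γ Γ.Ambient where
  dV := Γ.opV
  d0 := Γ.opZero
  dW := Γ.opW
  iV := Γ.inV
  i0 := Γ.inZero
  iW := Γ.inW
  E n := LinearMap.range (Γ.inPos n)
  d0_add := Γ.opZero_add
  d0_smul := Γ.opZero_smul
  i0_add := map_add _
  i0_smul c a := map_smul _ c a
  d0_dV := Γ.opZero_opV
  d0_dW := Γ.opZero_opW
  dV_dW := Γ.opV_opW
  dV_i0 := Γ.opV_inZero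
  d0_iV := Γ.opZero_inV
  dW_i0 := Γ.opW_inZero
  dV_iW := Γ.opV_inW
  dW_iV := Γ.opW_inV
  iV_mem x := ⟨x, rfl⟩
  dV_mem := by
    rintro n x _ ⟨u, rfl⟩
    exact ⟨_, (Γ.opV_inPos x n u).symm⟩
  d0_mem := by
    rintro n a _ ⟨u, rfl⟩
    exact ⟨_, (Γ.opZero_inPos a n u).symm⟩
  faithful := by
    rintro n _ ⟨u, rfl⟩ h
    have : u = 0 := tower_ext n fun y => by
      have := congrArg (fun z => z.2.2 n) (h y)
      simpa [opW_inPos_succ] using this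
    rw [this, map_zero]

/-- Auxiliary: the operators `[x, ·]`, `[a, ·]`, `[y, ·]`, seen from the negative side. -/
def negAction : LocalAction Γ.opp Γ.Ambient where
  dV := Γ.opW
  d0 := Γ.opZero
  dW := Γ.opV
  iV := Γ.inW
  i0 := Γ.inZero
  iW := Γ.inV
  E n := LinearMap.range (Γ.inNeg n)
  d0_add := Γ.opZero_add
  d0_smul := Γ.opZero_smul
  i0_add := map_add _
  i0_smul c a := map_smul _ c a
  d0_dV := Γ.opZero_opW
  d0_dW := Γ.opZero_opV
  dV_dW y x z := by
    rw [Γ.opV_opW, opp_bracket, ← neg_one_smul ℂ (Γ.bracket x y), opZero_smul]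
    simp
  dV_i0 := Γ.opW_inZero
  d0_iV := Γ.opZero_inW
  dW_i0 := Γ.opV_inZero
  dV_iW y x := by rw [opp_bracket, map_neg]; exact Γ.opW_inV y x
  dW_iV x y := by rw [opp_bracket, map_neg, neg_neg]; exact Γ.opV_inW x y
  iV_mem x := ⟨x, rfl⟩
  dV_mem := by
    rintro n x _ ⟨u, rfl⟩
    exact ⟨_, (Γ.opW_inNeg x n u).symm⟩
  d0_mem := by
    rintro n a _ ⟨u, rfl⟩
    exact ⟨_, (Γ.opZero_inNeg a n u).symm⟩
  faithful := by
    rintro n _ ⟨u, rfl⟩ h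
    have : u = 0 := tower_ext n fun y => by
      have := congrArg (fun z => z.1 n) (h y)
      simpa [opV_inNeg_succ] using this
    rw [this, map_zero]

/-- `IsAd D z` means that `D` is the operator `[z, ·]`. These operators are the given ones for
`z ∈ V, 𝔤, W`, and are defined inductively in the other degrees through
`[[γ, z], ·] = [γ, [z, ·]] - [z, [γ, ·]]` for `γ ∈ V, 𝔤, W`. -/
inductive IsAd : (Γ.Ambient →ₗ[ℂ] Γ.Ambient) → Γ.Ambient → Prop
  | baseV (x : V) : IsAd (Γ.opV x) (Γ.inV x)
  | baseZero (a : 𝔤) : IsAd (Γ.opZero a) (Γ.inZero a)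
  | baseW (y : W) : IsAd (Γ.opW y) (Γ.inW y)
  | stepV {D z} (x : V) : IsAd D z → IsAd (comm (Γ.opV x) D) (Γ.opV x z)
  | stepZero {D z} (a : 𝔤) : IsAd D z → IsAd (comm (Γ.opZero a) D) (Γ.opZero a z)
  | stepW {D z} (y : W) : IsAd D z → IsAd (comm (Γ.opW y) D) (Γ.opW y z)
  | add {D z D' z'} : IsAd D z → IsAd D' z' → IsAd (D + D') (z + z')
  | smul {D z} (c : ℂ) : IsAd D z → IsAd (c • D) (c • z)

/-- Auxiliary: sums of pairs `(ad z, z)` with homogeneous `z`. -/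
inductive Sorted : (Γ.Ambient →ₗ[ℂ] Γ.Ambient) → Γ.Ambient → Prop
  | pos {n D z} : Γ.posAction.Pair n D z → Sorted D z
  | zero (a : 𝔤) : Sorted (Γ.opZero a) (Γ.inZero a)
  | neg {n D z} : Γ.negAction.Pair n D z → Sorted D z
  | add {D z D' z'} : Sorted D z → Sorted D' z' → Sorted (D + D') (z + z')

variable {Γ}

lemma Sorted.smul {D z} (h : Γ.Sorted D z) (c : ℂ) : Γ.Sorted (c • D) (c • z) := by
  induction h with
  | pos h => exact .pos (.smul c h)
  | zero a => rw [← opZero_smul, ← map_smul]; exact .zero _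
  | neg h => exact .neg (.smul c h)
  | add _ _ ih ih' => rw [smul_add, smul_add]; exact .add ih ih'

lemma Sorted.opV {D z} (h : Γ.Sorted D z) (x : V) :
    Γ.Sorted (comm (Γ.opV x) D) (Γ.opV x z) := by
  induction h with
  | pos h => exact .pos (LocalAction.Pair.step x h)
  | zero a =>
    have : comm (Γ.opV x) (Γ.opZero a) = (-1 : ℂ) • Γ.opV ⁅a, x⁆ := by
      refine LinearMap.ext fun z => ?_
      rw [comm_apply, opZero_opV, LinearMap.smul_apply, neg_one_smul]; abel
    rw [this, opV_inZero, ← neg_one_smul ℂ (Γ.inV _)]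
    exact (Sorted.pos (LocalAction.Pair.base (α := Γ.posAction) ⁅a, x⁆)).smul _
  | @neg n D z h =>
    cases n with
    | zero =>
      obtain ⟨a, h1, h2⟩ := (h.dW x).1 rfl
      change comm (Γ.opV x) D = Γ.opZero a at h1
      change Γ.opV x z = Γ.inZero a at h2
      rw [h1, h2]; exact .zero a
    | succ n => exact .neg ((h.dW x).2 n rfl)
  | add _ _ ih ih' => rw [LocalAction.comm_add_right, map_add]; exact .add ih ih'

lemma Sorted.opW {D z} (h : Γ.Sorted D z) (y : W) :
    Γ.Sorted (comm (Γ.opW y) D) (Γ.opW y z) := by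
  induction h with
  | neg h => exact .neg (LocalAction.Pair.step y h)
  | zero a =>
    have : comm (Γ.opW y) (Γ.opZero a) = (-1 : ℂ) • Γ.opW ⁅a, y⁆ := by
      refine LinearMap.ext fun z => ?_
      rw [comm_apply, opZero_opW, LinearMap.smul_apply, neg_one_smul]; abel
    rw [this, opW_inZero, ← neg_one_smul ℂ (Γ.inW _)]
    exact (Sorted.neg (LocalAction.Pair.base (α := Γ.negAction) ⁅a, y⁆)).smul _
  | @pos n D z h =>
    cases n with
    | zero =>
      obtain ⟨a, h1, h2⟩ := (h.dW y).1 rfl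
      change comm (Γ.opW y) D = Γ.opZero a at h1
      change Γ.opW y z = Γ.inZero a at h2
      rw [h1, h2]; exact .zero a
    | succ n => exact .pos ((h.dW y).2 n rfl)
  | add _ _ ih ih' => rw [LocalAction.comm_add_right, map_add]; exact .add ih ih'

lemma Sorted.opZero {D z} (h : Γ.Sorted D z) (a : 𝔤) :
    Γ.Sorted (comm (Γ.opZero a) D) (Γ.opZero a z) := by
  induction h with
  | pos h => exact .pos (h.d0 a)
  | neg h => exact .neg (h.d0 a)
  | zero b =>
    have : comm (Γ.opZero a) (Γ.opZero b) = Γ.opZero ⁅a, b⁆ := by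
      refine LinearMap.ext fun z => ?_
      rw [comm_apply, opZero_opZero]; abel
    rw [this, opZero_inZero]; exact .zero _
  | add _ _ ih ih' => rw [LocalAction.comm_add_right, map_add]; exact .add ih ih'

lemma IsAd.sorted {D z} (h : Γ.IsAd D z) : Γ.Sorted D z := by
  induction h with
  | baseV x => exact .pos (LocalAction.Pair.base (α := Γ.posAction) x)
  | baseZero a => exact .zero a
  | baseW y => exact .neg (LocalAction.Pair.base (α := Γ.negAction) y)
  | stepV x _ ih => exact ih.opV x
  | stepZero a _ ih => exact ih.opZero a
  | stepW y _ ih => exact ih.opW y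
  | add _ _ ih ih' => exact .add ih ih'
  | smul c _ ih => exact ih.smul c

lemma Sorted.skew {D z} (h : Γ.Sorted D z) :
    (∀ x : V, D (Γ.inV x) + Γ.opV x z = 0) ∧ (∀ a, D (Γ.inZero a) + Γ.opZero a z = 0) ∧
      ∀ y : W, D (Γ.inW y) + Γ.opW y z = 0 := by
  induction h with
  | pos h =>
    obtain ⟨h1, h2, h3⟩ := LocalAction.Pair.skew _ _ _ h
    exact ⟨h3, h2, h1⟩
  | neg h => exact LocalAction.Pair.skew _ _ _ h
  | zero a =>
    refine ⟨fun x => ?_, fun b => ?_, fun y => ?_⟩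
    · rw [opV_inZero, opZero_inV, add_neg_cancel]
    · rw [opZero_inZero, opZero_inZero, ← map_add, ← lie_skew, neg_add_cancel, map_zero]
    · rw [opW_inZero, opZero_inW, add_neg_cancel]
  | @add D z D' z' _ _ ih ih' =>
    refine ⟨fun x => ?_, fun x => ?_, fun x => ?_⟩
    · rw [LinearMap.add_apply, map_add, add_add_add_comm, ih.1, ih'.1, add_zero]
    · rw [LinearMap.add_apply, map_add, add_add_add_comm, ih.2.1, ih'.2.1, add_zero]
    · rw [LinearMap.add_apply, map_add, add_add_add_comm, ih.2.2, ih'.2.2, add_zero]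

lemma comm_comm {A : Type w} [AddCommGroup A] [Module ℂ A] (D D₁ D₂ : A →ₗ[ℂ] A) :
    comm (comm D D₁) D₂ = comm D (comm D₁ D₂) + (-1 : ℂ) • comm D₁ (comm D D₂) := by
  ext z; simp; abel

lemma IsAd.skew {D z D' z'} (h : Γ.IsAd D z) (h' : Γ.IsAd D' z') : D z' + D' z = 0 := by
  have aux : ∀ {d D D' : Γ.Ambient →ₗ[ℂ] Γ.Ambient} {z z' : Γ.Ambient}, D z' + D' z = 0 →
      comm d D z' + D' (d z) = 0 → D (d z') + comm d D' z = 0 := by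
    intro d D D' z z' h1 h2
    have h3 := congrArg d h1
    rw [map_add, map_zero] at h3
    rw [comm_apply] at h2 ⊢
    have : D (d z') + (d (D' z) - D' (d z)) =
      (d (D z') + d (D' z)) - (d (D z') - D (d z') + D' (d z)) := by abel
    rw [this, h2, h3, sub_zero]
  induction h' generalizing D z with
  | baseV x => exact h.sorted.skew.1 x
  | baseZero a => exact h.sorted.skew.2.1 a
  | baseW y => exact h.sorted.skew.2.2 y
  | stepV x _ ih => exact aux (ih h) (ih (h.stepV x))
  | stepZero a _ ih => exact aux (ih h) (ih (h.stepZero a))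
  | stepW y _ ih => exact aux (ih h) (ih (h.stepW y))
  | add _ _ ih ih' =>
    rw [map_add, LinearMap.add_apply, add_add_add_comm, ih h, ih' h, add_zero]
  | smul c _ ih => rw [map_smul, LinearMap.smul_apply, ← smul_add, ih h, smul_zero]

lemma comm_apply' {A : Type w} [AddCommGroup A] [Module ℂ A] (d D : A →ₗ[ℂ] A) (z : A) :
    comm d D z = d (D z) + (-1 : ℂ) • D (d z) := by
  rw [comm_apply, neg_one_smul, sub_eq_add_neg]

lemma IsAd.comm {D z D' z'} (h : Γ.IsAd D z) (h' : Γ.IsAd D' z') :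
    Γ.IsAd (comm D D') (D z') := by
  induction h generalizing D' z' with
  | baseV x => exact h'.stepV x
  | baseZero a => exact h'.stepZero a
  | baseW y => exact h'.stepW y
  | stepV x _ ih =>
    rw [comm_comm, comm_apply']; exact .add ((ih h').stepV x) (.smul _ (ih (h'.stepV x)))
  | stepZero x _ ih =>
    rw [comm_comm, comm_apply']; exact .add ((ih h').stepZero x) (.smul _ (ih (h'.stepZero x)))
  | stepW x _ ih =>
    rw [comm_comm, comm_apply']; exact .add ((ih h').stepW x) (.smul _ (ih (h'.stepW x)))
  | @add D z D₂ z₂ _ _ ih ih' =>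
    have : LocalLieAlgebra.comm (D + D₂) D' =
        LocalLieAlgebra.comm D D' + LocalLieAlgebra.comm D₂ D' := by
      refine LinearMap.ext fun u => ?_
      simp only [comm_apply, LinearMap.add_apply, map_add]; abel
    rw [this, LinearMap.add_apply]; exact .add (ih h') (ih' h')
  | @smul D z c _ ih =>
    have : LocalLieAlgebra.comm (c • D) D' = c • LocalLieAlgebra.comm D D' := by
      refine LinearMap.ext fun u => ?_
      simp only [comm_apply, LinearMap.smul_apply, map_smul, smul_sub]
    rw [this, LinearMap.smul_apply]; exact .smul c (ih h')

lemma isAd_zero : Γ.IsAd 0 0 := by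
  simpa using IsAd.smul (0 : ℂ) (IsAd.baseZero (Γ := Γ) 0)

lemma exists_isAd {z : Γ.Ambient} (hz : z ∈ Γ.total) : ∃ D, Γ.IsAd D z := by
  refine Submodule.iSup_induction Γ.piece (motive := fun z => ∃ D, Γ.IsAd D z) hz ?_
    ⟨0, isAd_zero⟩ fun z z' ⟨D, h⟩ ⟨D', h'⟩ => ⟨D + D', h.add h'⟩
  clear hz z
  rintro ((_ | n) | n) z hz
  · obtain ⟨a, rfl⟩ := hz
    exact ⟨_, .baseZero a⟩
  · obtain ⟨u, hu, rfl⟩ := hz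
    induction n with
    | zero => exact ⟨_, IsAd.baseV (Γ := Γ) (show V from u)⟩
    | succ n ih =>
      refine Submodule.span_induction (fun u hu => ?_) ?_ (fun u u' _ _ hu hu' => ?_)
        (fun c u _ hu => ?_) hu
      · obtain ⟨x, u, hu, rfl⟩ := hu
        obtain ⟨D, hD⟩ := ih u hu
        rw [← opV_inPos]
        exact ⟨_, hD.stepV x⟩
      · rw [map_zero]; exact ⟨0, isAd_zero⟩
      · obtain ⟨D, h⟩ := hu
        obtain ⟨D', h'⟩ := hu'
        rw [map_add]; exact ⟨_, h.add h'⟩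
      · obtain ⟨D, h⟩ := hu
        rw [map_smul]; exact ⟨_, h.smul c⟩
  · obtain ⟨u, hu, rfl⟩ := hz
    induction n with
    | zero => exact ⟨_, IsAd.baseW (Γ := Γ) (show W from u)⟩
    | succ n ih =>
      refine Submodule.span_induction (fun u hu => ?_) ?_ (fun u u' _ _ hu hu' => ?_)
        (fun c u _ hu => ?_) hu
      · obtain ⟨x, u, hu, rfl⟩ := hu
        obtain ⟨D, hD⟩ := ih u hu
        rw [← opW_inNeg]
        exact ⟨_, hD.stepW x⟩
      · rw [map_zero]; exact ⟨0, isAd_zero⟩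
      · obtain ⟨D, h⟩ := hu
        obtain ⟨D', h'⟩ := hu'
        rw [map_add]; exact ⟨_, h.add h'⟩
      · obtain ⟨D, h⟩ := hu
        rw [map_smul]; exact ⟨_, h.smul c⟩

lemma IsAd.mem_total {D z} (h : Γ.IsAd D z) : z ∈ Γ.total := by
  have hpos : ∀ {n D z}, Γ.posAction.Pair n D z → z ∈ (Γ.component n).map (Γ.inPos n) := by
    intro n D z h
    induction h with
    | base x => exact ⟨x, trivial, rfl⟩
    | @step n D z x _ ih =>
      obtain ⟨u, hu, rfl⟩ := ih
      exact ⟨_, Submodule.subset_span ⟨x, u, hu, rfl⟩, (Γ.opV_inPos x n u).symm⟩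
    | add _ _ ih ih' => exact add_mem ih ih'
    | smul c _ ih => exact Submodule.smul_mem _ c ih
  have hneg : ∀ {n D z}, Γ.negAction.Pair n D z → z ∈ (Γ.opp.component n).map (Γ.inNeg n) := by
    intro n D z h
    induction h with
    | base x => exact ⟨x, trivial, rfl⟩
    | @step n D z x _ ih =>
      obtain ⟨u, hu, rfl⟩ := ih
      exact ⟨_, Submodule.subset_span ⟨x, u, hu, rfl⟩, (Γ.opW_inNeg x n u).symm⟩
    | add _ _ ih ih' => exact add_mem ih ih'
    | smul c _ ih => exact Submodule.smul_mem _ c ih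
  have hs := h.sorted
  clear h
  induction hs with
  | @pos n _ _ h => exact Submodule.mem_iSup_of_mem (Int.ofNat (n + 1)) (hpos h)
  | zero a => exact Submodule.mem_iSup_of_mem (Int.ofNat 0) ⟨a, rfl⟩
  | @neg n _ _ h => exact Submodule.mem_iSup_of_mem (Int.negSucc n) (hneg h)
  | add _ _ ih ih' => exact add_mem ih ih'

variable (Γ)

/-- The graded Lie algebra `⨁ U_k` constructed from a local Lie algebra. -/
def Alg : Type (max u v) := Γ.total

instance : AddCommGroup Γ.Alg := inferInstanceAs (AddCommGroup Γ.total)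

instance : Module ℂ Γ.Alg := inferInstanceAs (Module ℂ Γ.total)

/-- The operator `[z, ·]` on the ambient space (on `⨁ U_k` it depends only on `z`). -/
def ad (z : Γ.Alg) : Γ.Ambient →ₗ[ℂ] Γ.Ambient := (exists_isAd z.2).choose

lemma isAd_ad (z : Γ.Alg) : Γ.IsAd (Γ.ad z) z.1 := (exists_isAd z.2).choose_spec

instance : Bracket Γ.Alg Γ.Alg :=
  ⟨fun z z' => ⟨Γ.ad z z'.1, ((Γ.isAd_ad z).comm (Γ.isAd_ad z')).mem_total⟩⟩

lemma lie_val (z z' : Γ.Alg) {D} (h : Γ.IsAd D z.1) : (⁅z, z'⁆ : Γ.Alg).1 = D z'.1 := by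
  change Γ.ad z z'.1 = D z'.1
  have h1 := (Γ.isAd_ad z).skew (Γ.isAd_ad z')
  have h2 := h.skew (Γ.isAd_ad z')
  exact add_right_cancel (h1.trans h2.symm)

instance : LieRing Γ.Alg where
  add_lie x y z := Subtype.ext <| by
    rw [Γ.lie_val (x + y) z ((Γ.isAd_ad x).add (Γ.isAd_ad y))]; rfl
  lie_add x y z := Subtype.ext <| (Γ.ad x).map_add y.1 z.1
  lie_self x := Subtype.ext <| by
    have h := (Γ.isAd_ad x).skew (Γ.isAd_ad x)
    rw [← two_smul ℂ] at h
    exact (smul_eq_zero.1 h).resolve_left two_ne_zero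
  leibniz_lie x y z := Subtype.ext <| by
    change Γ.ad x (Γ.ad y z.1) = (⁅⁅x, y⁆, z⁆ : Γ.Alg).1 + Γ.ad y (Γ.ad x z.1)
    rw [Γ.lie_val ⁅x, y⁆ z ((Γ.isAd_ad x).comm (Γ.isAd_ad y)), comm_apply]; abel

instance : LieAlgebra ℂ Γ.Alg where
  lie_smul c x y := Subtype.ext <| (Γ.ad x).map_smul c y.1

/-- The homogeneous component of degree `k`. -/
def grade (k : ℤ) : Submodule ℂ Γ.Alg := (Γ.piece k).comap Γ.total.subtype

/-! ## Maximal and minimal graded Lie algebras with a given local part -/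

/-- The Lie algebra `G = ⨁ G_k` is graded by the subspaces `𝒢 k`, is generated by its local part
`G_{-1} ⊕ G_0 ⊕ G_1`, and `jW`, `jZero`, `jV` form an isomorphism of local Lie algebras from `Γ`
onto this local part. -/
structure IsGradedWithLocalPart {G : Type w} [LieRing G] [LieAlgebra ℂ G] (𝒢 : ℤ → Submodule ℂ G)
    (jW : W →ₗ[ℂ] G) (jZero : 𝔤 →ₗ[ℂ] G) (jV : V →ₗ[ℂ] G) : Prop where
  isInternal : DirectSum.IsInternal 𝒢
  lie_mem : ∀ k l x y, x ∈ 𝒢 k → y ∈ 𝒢 l → ⁅x, y⁆ ∈ 𝒢 (k + l)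
  generated : LieSubalgebra.lieSpan ℂ G ((𝒢 (-1) : Set G) ∪ 𝒢 0 ∪ 𝒢 1) = ⊤
  injective_W : Function.Injective jW
  injective_zero : Function.Injective jZero
  injective_V : Function.Injective jV
  range_W : LinearMap.range jW = 𝒢 (-1)
  range_zero : LinearMap.range jZero = 𝒢 0
  range_V : LinearMap.range jV = 𝒢 1
  map_zero_zero : ∀ a b, jZero ⁅a, b⁆ = ⁅jZero a, jZero b⁆
  map_zero_V : ∀ a x, jV ⁅a, x⁆ = ⁅jZero a, jV x⁆
  map_zero_W : ∀ a y, jW ⁅a, y⁆ = ⁅jZero a, jW y⁆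
  map_V_W : ∀ x y, jZero (Γ.bracket x y) = ⁅jV x, jW y⁆

/-- Kac's minimality: `G` is a graded Lie algebra with local part `Γ`, and for every graded Lie
algebra `G'` every isomorphism of its local part with that of `G` extends to an epimorphism of
`G'` onto `G`. (An isomorphism of the local parts is the same as an identification of the local
part of `G'` with `Γ`.) -/
def IsMinimal {G : Type (max u v)} [LieRing G] [LieAlgebra ℂ G] (𝒢 : ℤ → Submodule ℂ G)
    (jW : W →ₗ[ℂ] G) (jZero : 𝔤 →ₗ[ℂ] G) (jV : V →ₗ[ℂ] G) : Prop :=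
  Γ.IsGradedWithLocalPart 𝒢 jW jZero jV ∧
    ∀ (G' : Type w) [LieRing G'] [LieAlgebra ℂ G'] (𝒢' : ℤ → Submodule ℂ G')
      (jW' : W →ₗ[ℂ] G') (jZero' : 𝔤 →ₗ[ℂ] G') (jV' : V →ₗ[ℂ] G'),
      Γ.IsGradedWithLocalPart 𝒢' jW' jZero' jV' →
        ∃ f : G' →ₗ⁅ℂ⁆ G, Function.Surjective f ∧ (∀ k, (𝒢' k).map (f : G' →ₗ[ℂ] G) = 𝒢 k) ∧
          (∀ y, f (jW' y) = jW y) ∧ (∀ a, f (jZero' a) = jZero a) ∧ ∀ x, f (jV' x) = jV x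

/-- The free Lie algebra on the set `V ⊔ 𝔤 ⊔ W`. -/
abbrev Free (_Γ : LocalLieAlgebra 𝔤 V W) : Type (max u v) := FreeLieAlgebra ℂ (V ⊕ 𝔤 ⊕ W)

/-- The generator given by an element of `V`. -/
def freeV (x : V) : Γ.Free := FreeLieAlgebra.of ℂ (Sum.inl x)

/-- The generator given by an element of `𝔤`. -/
def freeZero (a : 𝔤) : Γ.Free := FreeLieAlgebra.of ℂ (Sum.inr (Sum.inl a))

/-- The generator given by an element of `W`. -/
def freeW (y : W) : Γ.Free := FreeLieAlgebra.of ℂ (Sum.inr (Sum.inr y))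

/-- The relations which make the maps from `V`, `𝔤`, `W` linear and which are satisfied in the
local Lie algebra. -/
inductive Relator : Γ.Free → Prop
  | addV (x x' : V) : Relator (Γ.freeV (x + x') - (Γ.freeV x + Γ.freeV x'))
  | smulV (c : ℂ) (x : V) : Relator (Γ.freeV (c • x) - c • Γ.freeV x)
  | addZero (a b : 𝔤) : Relator (Γ.freeZero (a + b) - (Γ.freeZero a + Γ.freeZero b))
  | smulZero (c : ℂ) (a : 𝔤) : Relator (Γ.freeZero (c • a) - c • Γ.freeZero a)
  | addW (y y' : W) : Relator (Γ.freeW (y + y') - (Γ.freeW y + Γ.freeW y'))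
  | smulW (c : ℂ) (y : W) : Relator (Γ.freeW (c • y) - c • Γ.freeW y)
  | lieZeroZero (a b : 𝔤) : Relator (Γ.freeZero ⁅a, b⁆ - ⁅Γ.freeZero a, Γ.freeZero b⁆)
  | lieZeroV (a : 𝔤) (x : V) : Relator (Γ.freeV ⁅a, x⁆ - ⁅Γ.freeZero a, Γ.freeV x⁆)
  | lieZeroW (a : 𝔤) (y : W) : Relator (Γ.freeW ⁅a, y⁆ - ⁅Γ.freeZero a, Γ.freeW y⁆)
  | lieVW (x : V) (y : W) : Relator (Γ.freeZero (Γ.bracket x y) - ⁅Γ.freeV x, Γ.freeW y⁆)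

/-- The ideal generated by the relations of the local Lie algebra. -/
def relIdeal : LieIdeal ℂ Γ.Free := LieSubmodule.lieSpan ℂ Γ.Free {r | Γ.Relator r}

/-- The maximal graded Lie algebra `g_max(Γ)` with local part `Γ`: the Lie algebra generated by
`W ⊕ 𝔤 ⊕ V` subject to the relations of the local Lie algebra. -/
abbrev GMax : Type (max u v) := Γ.Free ⧸ Γ.relIdeal

/-- The homogeneous elements of `g_max(Γ)`: elements of `V`, `𝔤`, `W` have degree `1`, `0`, `-1`,
and degrees add up under the bracket. -/
inductive Homogeneous : ℤ → Γ.GMax → Prop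
  | ofV (x : V) : Homogeneous 1 (LieSubmodule.Quotient.mk (Γ.freeV x))
  | ofZero (a : 𝔤) : Homogeneous 0 (LieSubmodule.Quotient.mk (Γ.freeZero a))
  | ofW (y : W) : Homogeneous (-1) (LieSubmodule.Quotient.mk (Γ.freeW y))
  | lie {k l : ℤ} {z z' : Γ.GMax} :
      Homogeneous k z → Homogeneous l z' → Homogeneous (k + l) ⁅z, z'⁆
  | zero (k : ℤ) : Homogeneous k 0
  | add {k : ℤ} {z z' : Γ.GMax} : Homogeneous k z → Homogeneous k z' → Homogeneous k (z + z')
  | smul {k : ℤ} {z : Γ.GMax} (c : ℂ) : Homogeneous k z → Homogeneous k (c • z)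

/-- The homogeneous component of degree `k` of `g_max(Γ)`. -/
def gradeMax (k : ℤ) : Submodule ℂ Γ.GMax where
  carrier := {z | Γ.Homogeneous k z}
  add_mem' h h' := .add h h'
  zero_mem' := .zero k
  smul_mem' c _ h := .smul c h

/-- An ideal is graded if it is the sum of its intersections with the homogeneous components. -/
def IsGradedIdeal {G : Type w} [LieRing G] [LieAlgebra ℂ G] (𝒢 : ℤ → Submodule ℂ G)
    (I : LieIdeal ℂ G) : Prop :=
  I.toSubmodule = ⨆ k, I.toSubmodule ⊓ 𝒢 k

/-- The sum of all graded ideals of `g_max(Γ)` which meet the local part trivially. -/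
def maxIdeal : LieIdeal ℂ Γ.GMax :=
  sSup {I | IsGradedIdeal Γ.gradeMax I ∧
    I.toSubmodule ⊓ (Γ.gradeMax (-1) ⊔ Γ.gradeMax 0 ⊔ Γ.gradeMax 1) = ⊥}

/-- The graded Lie algebra `g_min(Γ)`: the quotient of `g_max(Γ)` by the largest graded ideal which
meets the local part trivially. -/
abbrev GMin : Type (max u v) := Γ.GMax ⧸ Γ.maxIdeal

/-- The homogeneous component of degree `k` of `g_min(Γ)`. -/
def gradeMin (k : ℤ) : Submodule ℂ Γ.GMin :=
  (Γ.gradeMax k).map (LieSubmodule.Quotient.mk' Γ.maxIdeal : Γ.GMax →ₗ[ℂ] Γ.GMin)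

lemma mk_eq_mk {r s : Γ.Free} (h : Γ.Relator (r - s)) :
    (LieSubmodule.Quotient.mk r : Γ.GMax) = LieSubmodule.Quotient.mk s :=
  (Submodule.Quotient.eq _).2 (LieSubmodule.subset_lieSpan h)

/-- The map `V → g_min(Γ)`. -/
def minV : V →ₗ[ℂ] Γ.GMin where
  toFun x := LieSubmodule.Quotient.mk (LieSubmodule.Quotient.mk (Γ.freeV x) : Γ.GMax)
  map_add' x x' := congrArg (LieSubmodule.Quotient.mk (N := Γ.maxIdeal)) (Γ.mk_eq_mk (.addV x x'))
  map_smul' c x := congrArg (LieSubmodule.Quotient.mk (N := Γ.maxIdeal)) (Γ.mk_eq_mk (.smulV c x))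

/-- The map `𝔤 → g_min(Γ)`. -/
def minZero : 𝔤 →ₗ[ℂ] Γ.GMin where
  toFun a := LieSubmodule.Quotient.mk (LieSubmodule.Quotient.mk (Γ.freeZero a) : Γ.GMax)
  map_add' a b := congrArg (LieSubmodule.Quotient.mk (N := Γ.maxIdeal)) (Γ.mk_eq_mk (.addZero a b))
  map_smul' c a :=
    congrArg (LieSubmodule.Quotient.mk (N := Γ.maxIdeal)) (Γ.mk_eq_mk (.smulZero c a))

/-- The map `W → g_min(Γ)`. -/
def minW : W →ₗ[ℂ] Γ.GMin where
  toFun y := LieSubmodule.Quotient.mk (LieSubmodule.Quotient.mk (Γ.freeW y) : Γ.GMax)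
  map_add' y y' := congrArg (LieSubmodule.Quotient.mk (N := Γ.maxIdeal)) (Γ.mk_eq_mk (.addW y y'))
  map_smul' c y := congrArg (LieSubmodule.Quotient.mk (N := Γ.maxIdeal)) (Γ.mk_eq_mk (.smulW c y))

end LocalLieAlgebra

/-! ## Standard pentads and fundamental triplets -/

section Pentad

open TensorProduct

variable {𝔤 : Type u} {U : Type v} [LieRing 𝔤] [LieAlgebra ℂ 𝔤]
  [AddCommGroup U] [Module ℂ U] [LieRingModule 𝔤 U] [LieModule ℂ 𝔤 U]

/-- `(𝔤, π, U, 𝒰, B)` is a standard pentad; the representation `π` is the `𝔤`-module structure of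
`U`, and `𝒰` is a `𝔤`-submodule of `Hom(U, ℂ)`. -/
structure IsStandardPentad (𝒰 : LieSubmodule ℂ 𝔤 (Module.Dual ℂ U))
    (B : LinearMap.BilinForm ℂ 𝔤) : Prop where
  nondegenerate : B.Nondegenerate
  invariant : ∀ a b c : 𝔤, B ⁅a, b⁆ c = B a ⁅b, c⁆
  pairing_left : ∀ v : U, (∀ φ ∈ 𝒰, φ v = 0) → v = 0
  pairing_right : ∀ φ ∈ 𝒰, (∀ v : U, φ v = 0) → φ = 0
  exists_phi : ∃ Φ : U ⊗[ℂ] 𝒰 →ₗ[ℂ] 𝔤, ∀ (a : 𝔤) (v : U) (φ : 𝒰),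
    B a (Φ (v ⊗ₜ[ℂ] φ)) = (φ : Module.Dual ℂ U) ⁅a, v⁆

namespace IsStandardPentad

variable {𝒰 : LieSubmodule ℂ 𝔤 (Module.Dual ℂ U)} {B : LinearMap.BilinForm ℂ 𝔤}
  (P : IsStandardPentad 𝒰 B)

/-- The `Φ`-map of a standard pentad (it is unique because `B` is non-degenerate). -/
def phi : U ⊗[ℂ] 𝒰 →ₗ[ℂ] 𝔤 := P.exists_phi.choose

lemma form_phi (a : 𝔤) (v : U) (φ : 𝒰) :
    B a (P.phi (v ⊗ₜ[ℂ] φ)) = (φ : Module.Dual ℂ U) ⁅a, v⁆ := P.exists_phi.choose_spec a v φ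

/-- The local Lie algebra `𝒰 ⊕ 𝔤 ⊕ U` of a standard pentad, with `[v, φ] = Φ(v ⊗ φ)`. -/
def localPart : LocalLieAlgebra 𝔤 U 𝒰 where
  bracket := (TensorProduct.mk ℂ U 𝒰).compr₂ P.phi
  lie_bracket a v φ := by
    rw [← sub_eq_zero]
    refine P.nondegenerate.2 _ fun c => ?_
    simp only [LinearMap.compr₂_apply, TensorProduct.mk_apply, map_sub, map_add, form_phi,
      ← P.invariant, LieSubmodule.coe_bracket, Module.Dual.lie_apply]
    rw [lie_lie, map_sub]
    abel

/-- The Lie algebra `L(𝔤, π, U, 𝒰, B)`. -/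
abbrev L : Type (max u v) := P.localPart.Alg

/-- The graded components of `L(𝔤, π, U, 𝒰, B)`. -/
abbrev grade : ℤ → Submodule ℂ P.L := P.localPart.grade

end IsStandardPentad

/-- `(𝔤, B)` is a quadratic Lie algebra. -/
structure IsQuadratic (B : LinearMap.BilinForm ℂ 𝔤) : Prop where
  symm : B.IsSymm
  nondegenerate : B.Nondegenerate
  invariant : ∀ a b c : 𝔤, B ⁅a, b⁆ c = B a ⁅b, c⁆

/-- The local Lie algebra `Γ(𝔤, B, π) = U* ⊕ 𝔤 ⊕ U` of a fundamental triplet: for `v ∈ U` and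
`φ ∈ U*`, the element `[v, φ] ∈ 𝔤` is determined by `B([v, φ], a) = φ(π(a) v)` for all `a`. -/
def fundamental [FiniteDimensional ℂ 𝔤] (U : Type v) [AddCommGroup U] [Module ℂ U]
    [LieRingModule 𝔤 U] [LieModule ℂ 𝔤 U] {B : LinearMap.BilinForm ℂ 𝔤} (Q : IsQuadratic B) :
    LocalLieAlgebra 𝔤 U (Module.Dual ℂ U) where
  bracket := LinearMap.mk₂ ℂ
    (fun v φ => (B.toDual Q.nondegenerate).symm
      (φ ∘ₗ (LieModule.toEnd ℂ 𝔤 U : 𝔤 →ₗ[ℂ] Module.End ℂ U).flip v))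
    (fun v v' φ => by rw [← map_add]; congr 1; ext a; simp)
    (fun c v φ => by rw [← map_smul]; congr 1; ext a; simp)
    (fun v φ φ' => by rw [← map_add]; congr 1)
    (fun c v φ => by rw [← map_smul]; congr 1)
  lie_bracket a v φ := by
    rw [← sub_eq_zero]
    refine Q.nondegenerate.1 _ fun c => ?_
    rw [← lie_skew]
    simp only [map_sub, map_neg, map_add, LinearMap.sub_apply, LinearMap.neg_apply,
      LinearMap.add_apply, Q.invariant]
    simp only [LinearMap.mk₂_apply, LinearMap.BilinForm.apply_toDual_symm_apply,
      LinearMap.comp_apply, LinearMap.flip_apply, LieHom.coe_toLinearMap,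
      LieModule.toEnd_apply_apply, Module.Dual.lie_apply]
    rw [lie_lie, map_sub]
    abel

/-- The local Lie algebra `Γ(𝔤, B, π)` of a pentad with finite-dimensional `𝔤` and symmetric `B`. -/
abbrev IsStandardPentad.Gamma [FiniteDimensional ℂ 𝔤] {𝒰 : LieSubmodule ℂ 𝔤 (Module.Dual ℂ U)}
    {B : LinearMap.BilinForm ℂ 𝔤} (P : IsStandardPentad 𝒰 B) (hB : B.IsSymm) :
    LocalLieAlgebra 𝔤 U (Module.Dual ℂ U) :=
  fundamental U ⟨hB, P.nondegenerate, P.invariant⟩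

end Pentad

end SasanoPentad

end

/-!
# The Lie algebra of a standard pentad is a minimal graded Lie algebra

Call a graded Lie algebra `G = ⨁ G_k` with local part `Γ = W ⊕ 𝔤 ⊕ V` *transitive* if an element
of degree `≥ 2` (respectively `≤ -2`) vanishes as soon as it commutes with `W` (respectively `V`).
A transitive `G` which is generated by its local part is isomorphic to `g_min(Γ)`:

* By the Jacobi identity, brackets of elements of the local part can be rewritten as right-normed
  brackets of elements of `V` alone or of `W` alone (`IsLocalTriple.lie_mem_degSpan`). Hence the
  components of `g_max(Γ)`, and of every graded Lie algebra generated by its local part, are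
  spanned by right-normed brackets (`gradeMax_eq_degSpan`, `IsGradedWithLocalPart.eq_degSpan`).
  In particular `g_max(Γ)` has in degrees `-1`, `0`, `1` nothing but the images of `W`, `𝔤`, `V`,
  and `g_max(Γ) → G` maps components onto components.
* The kernel of `g_max(Γ) → G` is therefore a graded ideal which meets the local part trivially, so
  it is contained in `maxIdeal` (`ker_le_maxIdeal`). This gives `G → g_min(Γ)` for every `G`.
* If `G` is transitive, then by induction on the degree every graded ideal which meets the local
  part trivially is mapped to zero in `G` (`maxIdeal_le_ker`), so `G → g_min(Γ)` is injective.

The Lie algebra `⨁ U_k` of a local Lie algebra is transitive by construction, because an element of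
`U_{n+1}`, `n ≥ 1`, is a linear map `W → U_n`, given by the bracket (`isTransitive_alg`). For
finite-dimensional `𝔤` and `𝒰 = U*`, the local Lie algebra of the pentad is `Γ(𝔤, B, π)`, as in both
of them `[v, φ]` is determined by `B`. The existence of a transitive `G` also shows that the local
part of `g_min(Γ)` is `Γ`.
-/

namespace SasanoPentad.LocalLieAlgebra

/-! ### Right-normed brackets of a local triple -/

section DegSpan

variable {G : Type w} [LieRing G] [LieAlgebra ℂ G]

/-- The sum `N + Z + P` of subspaces of a Lie algebra, put in degrees `-1`, `0`, `1`, is closed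
under those brackets of homogeneous elements that have degree `-1`, `0` or `1`. -/
structure IsLocalTriple (N Z P : Submodule ℂ G) : Prop where
  zero_zero : ∀ a ∈ Z, ∀ b ∈ Z, ⁅a, b⁆ ∈ Z
  zero_pos : ∀ a ∈ Z, ∀ x ∈ P, ⁅a, x⁆ ∈ P
  zero_neg : ∀ a ∈ Z, ∀ y ∈ N, ⁅a, y⁆ ∈ N
  pos_neg : ∀ x ∈ P, ∀ y ∈ N, ⁅x, y⁆ ∈ Z

/-- The subspace spanned by the iterated brackets `[x₀, [x₁, …, [xₙ₋₁, xₙ]]]` of elements of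
`P`. -/
def iterLie (P : Submodule ℂ G) : ℕ → Submodule ℂ G
  | 0 => P
  | n + 1 => Submodule.map₂ (LieModule.toEnd ℂ G G : G →ₗ[ℂ] Module.End ℂ G) P (iterLie P n)

/-- The component of degree `k` of the subalgebra generated by subspaces `N`, `Z`, `P` of degrees
`-1`, `0`, `1` which form a local triple: it is `Z` in degree `0`, and in degree `±n` it is spanned
by right-normed brackets of `n` elements of `P` or of `N`. -/
def degSpan (N Z P : Submodule ℂ G) : ℤ → Submodule ℂ G
  | Int.ofNat 0 => Z
  | Int.ofNat (n + 1) => iterLie P n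
  | Int.negSucc n => iterLie N n

lemma lie_mem_iterLie {P : Submodule ℂ G} {x z : G} {n : ℕ} (hx : x ∈ P)
    (hz : z ∈ iterLie P n) : ⁅x, z⁆ ∈ iterLie P (n + 1) :=
  Submodule.apply_mem_map₂ (LieModule.toEnd ℂ G G : G →ₗ[ℂ] Module.End ℂ G) hx hz

lemma iterLie_succ_le {P Q : Submodule ℂ G} {n : ℕ}
    (h : ∀ x ∈ P, ∀ z ∈ iterLie P n, ⁅x, z⁆ ∈ Q) : iterLie P (n + 1) ≤ Q :=
  Submodule.map₂_le.2 h

lemma map_iterLie {G' : Type*} [LieRing G'] [LieAlgebra ℂ G'] (f : G →ₗ⁅ℂ⁆ G')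
    (P : Submodule ℂ G) (n : ℕ) :
    (iterLie P n).map (f : G →ₗ[ℂ] G') = iterLie (P.map (f : G →ₗ[ℂ] G')) n := by
  induction n with
  | zero => rfl
  | succ n ih =>
    refine le_antisymm (Submodule.map_le_iff_le_comap.2 <| iterLie_succ_le fun x hx z hz => ?_)
      (iterLie_succ_le ?_)
    · change f ⁅x, z⁆ ∈ iterLie _ (n + 1)
      rw [LieHom.map_lie]
      exact lie_mem_iterLie ⟨x, hx, rfl⟩ (ih ▸ ⟨z, hz, rfl⟩)
    · rw [← ih]
      rintro _ ⟨x, hx, rfl⟩ _ ⟨z, hz, rfl⟩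
      exact ⟨⁅x, z⁆, lie_mem_iterLie hx hz, LieHom.map_lie f x z⟩

lemma map_degSpan {G' : Type*} [LieRing G'] [LieAlgebra ℂ G'] (f : G →ₗ⁅ℂ⁆ G')
    (N Z P : Submodule ℂ G) (k : ℤ) :
    (degSpan N Z P k).map (f : G →ₗ[ℂ] G') = degSpan (N.map (f : G →ₗ[ℂ] G'))
      (Z.map (f : G →ₗ[ℂ] G')) (P.map (f : G →ₗ[ℂ] G')) k := by
  obtain (_ | n) | n := k
  · rfl
  · exact map_iterLie f P n
  · exact map_iterLie f N n

lemma degSpan_neg (N Z P : Submodule ℂ G) (k : ℤ) : degSpan P Z N (-k) = degSpan N Z P k := by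
  obtain (_ | n) | n := k <;> rfl

namespace IsLocalTriple

variable {N Z P : Submodule ℂ G} (h : IsLocalTriple N Z P)
include h

lemma symm : IsLocalTriple P Z N where
  zero_zero := h.zero_zero
  zero_pos := h.zero_neg
  zero_neg := h.zero_pos
  pos_neg y hy x hx := by
    rw [← lie_skew]
    exact neg_mem (h.pos_neg x hx y hy)

lemma zero_lie_iterLie {a : G} (ha : a ∈ Z) (n : ℕ) : ∀ z ∈ iterLie P n, ⁅a, z⁆ ∈ iterLie P n := by
  induction n with
  | zero => exact h.zero_pos a ha
  | succ n ih =>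
    change iterLie P (n + 1) ≤ (iterLie P (n + 1)).comap (LieModule.toEnd ℂ G G a)
    refine iterLie_succ_le fun x hx z hz => ?_
    change ⁅a, ⁅x, z⁆⁆ ∈ iterLie P (n + 1)
    rw [leibniz_lie]
    exact add_mem (lie_mem_iterLie (h.zero_pos a ha x hx) hz) (lie_mem_iterLie hx (ih z hz))

lemma neg_lie_iterLie_succ {y : G} (hy : y ∈ N) (n : ℕ) :
    ∀ z ∈ iterLie P (n + 1), ⁅y, z⁆ ∈ iterLie P n := by
  induction n with
  | zero =>
    change iterLie P 1 ≤ (iterLie P 0).comap (LieModule.toEnd ℂ G G y)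
    refine iterLie_succ_le fun x hx z hz => ?_
    change ⁅y, ⁅x, z⁆⁆ ∈ P
    rw [leibniz_lie, ← lie_skew x]
    exact add_mem (h.zero_pos _ (h.symm.pos_neg y hy x hx) z hz)
      (neg_mem (h.zero_pos _ (h.symm.pos_neg y hy z hz) x hx))
  | succ n ih =>
    change iterLie P (n + 2) ≤ (iterLie P (n + 1)).comap (LieModule.toEnd ℂ G G y)
    refine iterLie_succ_le fun x hx z hz => ?_
    change ⁅y, ⁅x, z⁆⁆ ∈ iterLie P (n + 1)
    rw [leibniz_lie]
    exact add_mem (h.zero_lie_iterLie (h.symm.pos_neg y hy x hx) _ z hz)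
      (lie_mem_iterLie hx (ih z hz))

lemma zero_lie_degSpan {a : G} (ha : a ∈ Z) (k : ℤ) :
    ∀ z ∈ degSpan N Z P k, ⁅a, z⁆ ∈ degSpan N Z P k := by
  obtain (_ | n) | n := k
  · exact h.zero_zero a ha
  · exact h.zero_lie_iterLie ha n
  · exact h.symm.zero_lie_iterLie ha n

lemma pos_lie_degSpan {x : G} (hx : x ∈ P) (k : ℤ) :
    ∀ z ∈ degSpan N Z P k, ⁅x, z⁆ ∈ degSpan N Z P (1 + k) := by
  intro z hz
  rw [add_comm]
  obtain (_ | n) | n := k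
  · rw [← lie_skew]
    exact neg_mem (h.zero_pos z hz x hx)
  · exact lie_mem_iterLie hx hz
  · cases n with
    | zero => exact h.pos_neg x hx z hz
    | succ n => exact h.symm.neg_lie_iterLie_succ hx n z hz

lemma iterLie_lie_degSpan (n : ℕ) : ∀ z ∈ iterLie P n, ∀ (l : ℤ), ∀ u ∈ degSpan N Z P l,
    ⁅z, u⁆ ∈ degSpan N Z P ((n + 1 : ℕ) + l) := by
  induction n with
  | zero => exact fun z hz l u hu => h.pos_lie_degSpan hz l u hu
  | succ n ih =>
    intro z hz l u hu
    refine (iterLie_succ_le (Q := (degSpan N Z P ((n + 2 : ℕ) + l)).comap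
      ((LieModule.toEnd ℂ G G : G →ₗ[ℂ] Module.End ℂ G).flip u)) fun x hx z hz => ?_) hz
    change ⁅⁅x, z⁆, u⁆ ∈ degSpan N Z P ((n + 2 : ℕ) + l)
    rw [lie_lie]
    have h1 := h.pos_lie_degSpan hx _ _ (ih z hz l u hu)
    have h2 := ih z hz _ _ (h.pos_lie_degSpan hx l u hu)
    refine sub_mem ?_ ?_
    · convert h1 using 2; push_cast; ring
    · convert h2 using 2; push_cast; ring

/-- By the Jacobi identity, right-normed brackets of elements of a local triple are closed under
the bracket, and the degrees add up. -/
lemma lie_mem_degSpan {k l : ℤ} {z u : G} (hz : z ∈ degSpan N Z P k) (hu : u ∈ degSpan N Z P l) :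
    ⁅z, u⁆ ∈ degSpan N Z P (k + l) := by
  obtain (_ | n) | n := k
  · convert h.zero_lie_degSpan hz l u hu using 2
    exact zero_add l
  · exact h.iterLie_lie_degSpan n z hz l u hu
  · rw [← degSpan_neg] at hu ⊢
    convert h.symm.iterLie_lie_degSpan n z hz _ u hu using 2
    rw [Int.negSucc_eq]; push_cast; ring

/-- The subalgebra generated by a local triple is the sum of its homogeneous components. -/
lemma iSup_degSpan :
    ⨆ k, degSpan N Z P k = (LieSubalgebra.lieSpan ℂ G ((N : Set G) ∪ Z ∪ P)).toSubmodule := by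
  apply le_antisymm
  · have key : ∀ (Q : Submodule ℂ G), (Q : Set G) ⊆ (N : Set G) ∪ Z ∪ P → ∀ n,
        iterLie Q n ≤ (LieSubalgebra.lieSpan ℂ G ((N : Set G) ∪ Z ∪ P)).toSubmodule := by
      intro Q hQ n
      induction n with
      | zero => exact hQ.trans LieSubalgebra.subset_lieSpan
      | succ n ih =>
        exact iterLie_succ_le fun x hx z hz =>
          LieSubalgebra.lie_mem _ (LieSubalgebra.subset_lieSpan (hQ hx)) (ih hz)
    refine iSup_le fun k => ?_
    obtain (_ | n) | n := k
    · exact key Z (fun z hz => .inl (.inr hz)) 0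
    · exact key P (fun z hz => .inr hz) n
    · exact key N (fun z hz => .inl (.inl hz)) n
  · let S : LieSubalgebra ℂ G :=
      { toSubmodule := ⨆ k, degSpan N Z P k
        lie_mem' := by
          intro z u hz hu
          refine Submodule.iSup_induction _ (motive := fun z => ⁅z, u⁆ ∈ ⨆ k, degSpan N Z P k) hz
            (fun k z hz => ?_) (by simp) fun z z' h1 h2 => by rw [add_lie]; exact add_mem h1 h2
          refine Submodule.iSup_induction _ (motive := fun u => ⁅z, u⁆ ∈ ⨆ k, degSpan N Z P k) hu
            (fun l u hu => ?_) (by simp) fun u u' h1 h2 => by rw [lie_add]; exact add_mem h1 h2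
          exact Submodule.mem_iSup_of_mem _ (h.lie_mem_degSpan hz hu) }
    change LieSubalgebra.lieSpan ℂ G _ ≤ S
    refine LieSubalgebra.lieSpan_le.2 ?_
    rintro z ((hz | hz) | hz)
    · exact Submodule.mem_iSup_of_mem (p := degSpan N Z P) (Int.negSucc 0) hz
    · exact Submodule.mem_iSup_of_mem (p := degSpan N Z P) 0 hz
    · exact Submodule.mem_iSup_of_mem (p := degSpan N Z P) 1 hz

end IsLocalTriple

end DegSpan

/-! ### Homomorphisms on Lie algebras given by generators and relations -/

/-- A homomorphism of Lie algebras factors through a surjective one whose kernel it kills. -/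
lemma exists_lieHom_comp_eq {R L L₁ L₂ : Type*} [CommRing R] [LieRing L] [LieAlgebra R L]
    [LieRing L₁] [LieAlgebra R L₁] [LieRing L₂] [LieAlgebra R L₂] (f : L →ₗ⁅R⁆ L₁)
    (hf : Function.Surjective f) (g : L →ₗ⁅R⁆ L₂) (hfg : ∀ x, f x = 0 → g x = 0) :
    ∃ h : L₁ →ₗ⁅R⁆ L₂, ∀ x, h (f x) = g x := by
  have key : ∀ x, g (Function.surjInv hf (f x)) = g x := fun x => by
    rw [← sub_eq_zero, ← map_sub]
    exact hfg _ (by rw [map_sub, Function.surjInv_eq hf, sub_self])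
  refine ⟨{ toFun := fun y => g (Function.surjInv hf y), map_add' := ?_, map_smul' := ?_,
            map_lie' := ?_ }, key⟩
  · intro y y'
    obtain ⟨x, rfl⟩ := hf y
    obtain ⟨x', rfl⟩ := hf y'
    rw [← map_add, key, key, key, map_add]
  · intro c y
    obtain ⟨x, rfl⟩ := hf y
    rw [← map_smul, key, key, map_smul]; rfl
  · intro y y'
    obtain ⟨x, rfl⟩ := hf y
    obtain ⟨x', rfl⟩ := hf y'
    rw [← LieHom.map_lie, key, LieHom.map_lie]
    exact (congrArg₂ _ (key x) (key x')).symm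

/-- The canonical homomorphism onto a quotient Lie algebra. -/
def quotHom {L : Type w} [LieRing L] [LieAlgebra ℂ L] (I : LieIdeal ℂ L) : L →ₗ⁅ℂ⁆ L ⧸ I where
  __ := (LieSubmodule.Quotient.mk' I : L →ₗ[ℂ] L ⧸ I)
  map_lie' := rfl

lemma quotHom_surjective {L : Type w} [LieRing L] [LieAlgebra ℂ L] (I : LieIdeal ℂ L) :
    Function.Surjective (quotHom I) :=
  LieSubmodule.Quotient.surjective_mk' I

lemma quotHom_eq_zero {L : Type w} [LieRing L] [LieAlgebra ℂ L] {I : LieIdeal ℂ L} {x : L} :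
    quotHom I x = 0 ↔ x ∈ I :=
  LieSubmodule.Quotient.mk_eq_zero I

/-! ### Graded Lie algebras with a given local part -/

/-- The kernel of a homomorphism which maps a spanning family of subspaces into an independent one
is a graded ideal. -/
lemma isGradedIdeal_ker {G : Type w} {G' : Type*} [LieRing G] [LieAlgebra ℂ G] [LieRing G']
    [LieAlgebra ℂ G'] {𝒢 : ℤ → Submodule ℂ G} {𝒢' : ℤ → Submodule ℂ G'} (htop : ⨆ k, 𝒢 k = ⊤)
    (hind : iSupIndep 𝒢') (f : G →ₗ⁅ℂ⁆ G') (hf : ∀ k, ∀ x ∈ 𝒢 k, f x ∈ 𝒢' k) :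
    IsGradedIdeal 𝒢 f.ker := by
  refine le_antisymm (fun z hz => ?_) (iSup_le fun k => inf_le_left)
  have hz0 : f z = 0 := LieHom.mem_ker.1 hz
  obtain ⟨c, hc, rfl⟩ := (Submodule.mem_iSup_iff_exists_finsupp 𝒢 z).1 (htop ▸ Submodule.mem_top)
  rw [Finsupp.sum, map_sum] at hz0
  have h0 := (iSupIndep_iff_finsetSum_eq_zero_imp_eq_zero 𝒢').1 hind c.support
    (fun k => f (c k)) (fun k _ => hf k _ (hc k)) hz0
  refine Submodule.sum_mem _ fun k hk => Submodule.mem_iSup_of_mem k ⟨?_, hc k⟩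
  exact LieHom.mem_ker.2 (h0 k hk)

lemma degSpan_le {G : Type w} [LieRing G] [LieAlgebra ℂ G] {𝒢 : ℤ → Submodule ℂ G}
    (hlie : ∀ k l x y, x ∈ 𝒢 k → y ∈ 𝒢 l → ⁅x, y⁆ ∈ 𝒢 (k + l)) {N Z P : Submodule ℂ G}
    (hN : N ≤ 𝒢 (-1)) (hZ : Z ≤ 𝒢 0) (hP : P ≤ 𝒢 1) (k : ℤ) : degSpan N Z P k ≤ 𝒢 k := by
  obtain (_ | n) | n := k
  · exact hZ
  · change iterLie P n ≤ 𝒢 ((n + 1 : ℕ) : ℤ)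
    induction n with
    | zero => exact hP
    | succ n ih =>
      refine iterLie_succ_le fun x hx z hz => ?_
      convert hlie _ _ _ _ (hP hx) (ih hz) using 2
      push_cast; ring
  · change iterLie N n ≤ 𝒢 (Int.negSucc n)
    induction n with
    | zero => exact hN
    | succ n ih =>
      refine iterLie_succ_le fun x hx z hz => ?_
      convert hlie _ _ _ _ (hN hx) (ih hz) using 2
      rw [Int.negSucc_eq, Int.negSucc_eq]; push_cast; ring

variable {𝔤 : Type u} {V W : Type v} [LieRing 𝔤] [LieAlgebra ℂ 𝔤]
  [AddCommGroup V] [Module ℂ V] [LieRingModule 𝔤 V] [LieModule ℂ 𝔤 V]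
  [AddCommGroup W] [Module ℂ W] [LieRingModule 𝔤 W] [LieModule ℂ 𝔤 W]

/-- The linear maps `jW`, `jZero`, `jV` into a Lie algebra `G` respect the brackets of the local
Lie algebra `Γ`. -/
structure IsLocalHom (Γ : LocalLieAlgebra 𝔤 V W) {G : Type*} [LieRing G] [LieAlgebra ℂ G]
    (jW : W →ₗ[ℂ] G) (jZero : 𝔤 →ₗ[ℂ] G) (jV : V →ₗ[ℂ] G) : Prop where
  map_zero_zero : ∀ a b, jZero ⁅a, b⁆ = ⁅jZero a, jZero b⁆
  map_zero_V : ∀ a x, jV ⁅a, x⁆ = ⁅jZero a, jV x⁆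
  map_zero_W : ∀ a y, jW ⁅a, y⁆ = ⁅jZero a, jW y⁆
  map_V_W : ∀ x y, jZero (Γ.bracket x y) = ⁅jV x, jW y⁆

variable {Γ : LocalLieAlgebra 𝔤 V W} {G : Type*} [LieRing G] [LieAlgebra ℂ G]
  {jW : W →ₗ[ℂ] G} {jZero : 𝔤 →ₗ[ℂ] G} {jV : V →ₗ[ℂ] G}

namespace IsLocalHom

lemma isLocalTriple (h : Γ.IsLocalHom jW jZero jV) :
    IsLocalTriple (LinearMap.range jW) (LinearMap.range jZero) (LinearMap.range jV) where
  zero_zero := by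
    rintro _ ⟨a, rfl⟩ _ ⟨b, rfl⟩
    exact ⟨_, h.map_zero_zero a b⟩
  zero_pos := by
    rintro _ ⟨a, rfl⟩ _ ⟨x, rfl⟩
    exact ⟨_, h.map_zero_V a x⟩
  zero_neg := by
    rintro _ ⟨a, rfl⟩ _ ⟨y, rfl⟩
    exact ⟨_, h.map_zero_W a y⟩
  pos_neg := by
    rintro _ ⟨x, rfl⟩ _ ⟨y, rfl⟩
    exact ⟨_, h.map_V_W x y⟩

lemma comp {G' : Type*} [LieRing G'] [LieAlgebra ℂ G'] (h : Γ.IsLocalHom jW jZero jV)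
    (f : G →ₗ⁅ℂ⁆ G') : Γ.IsLocalHom ((f : G →ₗ[ℂ] G') ∘ₗ jW) ((f : G →ₗ[ℂ] G') ∘ₗ jZero)
      ((f : G →ₗ[ℂ] G') ∘ₗ jV) where
  map_zero_zero a b := (congrArg f (h.map_zero_zero a b)).trans (f.map_lie _ _)
  map_zero_V a x := (congrArg f (h.map_zero_V a x)).trans (f.map_lie _ _)
  map_zero_W a y := (congrArg f (h.map_zero_W a y)).trans (f.map_lie _ _)
  map_V_W x y := (congrArg f (h.map_V_W x y)).trans (f.map_lie _ _)

end IsLocalHom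

lemma isGradedWithLocalPart_degSpan (h : Γ.IsLocalHom jW jZero jV)
    (hW : Function.Injective jW) (hZero : Function.Injective jZero) (hV : Function.Injective jV)
    (hind : iSupIndep (degSpan (LinearMap.range jW) (LinearMap.range jZero) (LinearMap.range jV)))
    (htop : ⨆ k, degSpan (LinearMap.range jW) (LinearMap.range jZero) (LinearMap.range jV) k = ⊤) :
    Γ.IsGradedWithLocalPart
      (degSpan (LinearMap.range jW) (LinearMap.range jZero) (LinearMap.range jV)) jW jZero jV where
  isInternal := DirectSum.isInternal_submodule_of_iSupIndep_of_iSup_eq_top hind htop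
  lie_mem _ _ _ _ hx hy := h.isLocalTriple.lie_mem_degSpan hx hy
  generated := by
    rw [h.isLocalTriple.iSup_degSpan] at htop
    exact LieSubalgebra.toSubmodule_injective htop
  injective_W := hW
  injective_zero := hZero
  injective_V := hV
  range_W := rfl
  range_zero := rfl
  range_V := rfl
  map_zero_zero := h.map_zero_zero
  map_zero_V := h.map_zero_V
  map_zero_W := h.map_zero_W
  map_V_W := h.map_V_W

namespace IsGradedWithLocalPart

variable {𝒢 : ℤ → Submodule ℂ G}

lemma isLocalHom (h : Γ.IsGradedWithLocalPart 𝒢 jW jZero jV) : Γ.IsLocalHom jW jZero jV where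
  map_zero_zero := h.map_zero_zero
  map_zero_V := h.map_zero_V
  map_zero_W := h.map_zero_W
  map_V_W := h.map_V_W

lemma iSupIndep (h : Γ.IsGradedWithLocalPart 𝒢 jW jZero jV) : iSupIndep 𝒢 :=
  ((DirectSum.isInternal_submodule_iff_iSupIndep_and_iSup_eq_top 𝒢).1 h.isInternal).1

lemma iSup_eq_top (h : Γ.IsGradedWithLocalPart 𝒢 jW jZero jV) : ⨆ k, 𝒢 k = ⊤ :=
  ((DirectSum.isInternal_submodule_iff_iSupIndep_and_iSup_eq_top 𝒢).1 h.isInternal).2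

/-- A grading of a Lie algebra generated by its local part is determined by the local part: the
iterated brackets already span the algebra, and they lie in the respective components. -/
lemma eq_degSpan (h : Γ.IsGradedWithLocalPart 𝒢 jW jZero jV) (k : ℤ) :
    𝒢 k = degSpan (LinearMap.range jW) (LinearMap.range jZero) (LinearMap.range jV) k := by
  rw [h.range_W, h.range_zero, h.range_V]
  have hle := degSpan_le h.lie_mem le_rfl le_rfl le_rfl
  have htop : ⨆ l, degSpan (𝒢 (-1)) (𝒢 0) (𝒢 1) l = ⊤ := by
    have ht := h.isLocalHom.isLocalTriple
    rw [h.range_W, h.range_zero, h.range_V] at ht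
    rw [ht.iSup_degSpan, h.generated]
    rfl
  refine le_antisymm ?_ (hle k)
  have hsup : (⊤ : Submodule ℂ G) ≤
      degSpan (𝒢 (-1)) (𝒢 0) (𝒢 1) k ⊔ ⨆ (l) (_ : l ≠ k), 𝒢 l := by
    rw [← htop]
    refine iSup_le fun l => ?_
    by_cases hl : l = k
    · subst hl; exact le_sup_left
    · exact (hle l).trans (le_sup_of_le_right (le_iSup₂_of_le (f := fun l (_ : l ≠ k) => 𝒢 l) l hl le_rfl))
  calc 𝒢 k ≤ (degSpan (𝒢 (-1)) (𝒢 0) (𝒢 1) k ⊔ ⨆ (l) (_ : l ≠ k), 𝒢 l) ⊓ 𝒢 k :=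
        le_inf (le_top.trans hsup) le_rfl
    _ = degSpan (𝒢 (-1)) (𝒢 0) (𝒢 1) k ⊔ (⨆ (l) (_ : l ≠ k), 𝒢 l) ⊓ 𝒢 k :=
        sup_inf_assoc_of_le _ (hle k)
    _ = degSpan (𝒢 (-1)) (𝒢 0) (𝒢 1) k := by
        rw [inf_comm, (h.iSupIndep k).eq_bot, sup_bot_eq]

/-- The property of being graded with a given local part does not change when the part of degree
`-1` is replaced by an isomorphic module. -/
lemma congr_W {W' : Type v} [AddCommGroup W'] [Module ℂ W'] [LieRingModule 𝔤 W']
    [LieModule ℂ 𝔤 W'] {Γ' : LocalLieAlgebra 𝔤 V W'} (h : Γ.IsGradedWithLocalPart 𝒢 jW jZero jV)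
    (e : W' ≃ₗ⁅ℂ,𝔤⁆ W) (he : ∀ x y, Γ.bracket x (e y) = Γ'.bracket x y) :
    Γ'.IsGradedWithLocalPart 𝒢 (jW ∘ₗ (e : W' →ₗ[ℂ] W)) jZero jV where
  isInternal := h.isInternal
  lie_mem := h.lie_mem
  generated := h.generated
  injective_W := h.injective_W.comp e.injective
  injective_zero := h.injective_zero
  injective_V := h.injective_V
  range_W := by
    rw [← h.range_W]
    exact LinearMap.range_comp_of_range_eq_top _ (LinearMap.range_eq_top.2 e.surjective)
  range_zero := h.range_zero
  range_V := h.range_V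
  map_zero_zero := h.map_zero_zero
  map_zero_V := h.map_zero_V
  map_zero_W a y := (congrArg jW (e.toLieModuleHom.map_lie a y)).trans (h.map_zero_W a (e y))
  map_V_W x y := by
    rw [← he]
    exact h.map_V_W x (e y)

end IsGradedWithLocalPart

/-! ### The maximal graded Lie algebra -/

variable (Γ)

/-- The map `V → g_max(Γ)`. -/
noncomputable def maxV : V →ₗ[ℂ] Γ.GMax where
  toFun x := LieSubmodule.Quotient.mk (Γ.freeV x)
  map_add' x x' := Γ.mk_eq_mk (.addV x x')
  map_smul' c x := Γ.mk_eq_mk (.smulV c x)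

/-- The map `𝔤 → g_max(Γ)`. -/
noncomputable def maxZero : 𝔤 →ₗ[ℂ] Γ.GMax where
  toFun a := LieSubmodule.Quotient.mk (Γ.freeZero a)
  map_add' a b := Γ.mk_eq_mk (.addZero a b)
  map_smul' c a := Γ.mk_eq_mk (.smulZero c a)

/-- The map `W → g_max(Γ)`. -/
noncomputable def maxW : W →ₗ[ℂ] Γ.GMax where
  toFun y := LieSubmodule.Quotient.mk (Γ.freeW y)
  map_add' y y' := Γ.mk_eq_mk (.addW y y')
  map_smul' c y := Γ.mk_eq_mk (.smulW c y)

lemma isLocalHom_max : Γ.IsLocalHom Γ.maxW Γ.maxZero Γ.maxV where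
  map_zero_zero a b := Γ.mk_eq_mk (.lieZeroZero a b)
  map_zero_V a x := Γ.mk_eq_mk (.lieZeroV a x)
  map_zero_W a y := Γ.mk_eq_mk (.lieZeroW a y)
  map_V_W x y := Γ.mk_eq_mk (.lieVW x y)

variable {Γ}

/-- The universal property of `g_max(Γ)`. -/
lemma IsLocalHom.exists_lift (h : Γ.IsLocalHom jW jZero jV) :
    ∃ f : Γ.GMax →ₗ⁅ℂ⁆ G, (∀ y, f (Γ.maxW y) = jW y) ∧ (∀ a, f (Γ.maxZero a) = jZero a) ∧
      ∀ x, f (Γ.maxV x) = jV x := by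
  let F : Γ.Free →ₗ⁅ℂ⁆ G := FreeLieAlgebra.lift ℂ (Sum.elim jV (Sum.elim jZero jW))
  have hFV : ∀ x, F (Γ.freeV x) = jV x := fun x => FreeLieAlgebra.lift_of_apply _ _
  have hF0 : ∀ a, F (Γ.freeZero a) = jZero a := fun a => FreeLieAlgebra.lift_of_apply _ _
  have hFW : ∀ y, F (Γ.freeW y) = jW y := fun y => FreeLieAlgebra.lift_of_apply _ _
  have hrel : Γ.relIdeal ≤ F.ker := by
    refine LieSubmodule.lieSpan_le.2 fun r hr => LieHom.mem_ker.2 ?_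
    induction hr with
    | lieZeroZero a b => simp [hF0, h.map_zero_zero]
    | lieZeroV a x => simp [hF0, hFV, h.map_zero_V]
    | lieZeroW a y => simp [hF0, hFW, h.map_zero_W]
    | lieVW x y => simp [hF0, hFV, hFW, h.map_V_W]
    | _ => simp [hF0, hFV, hFW]
  obtain ⟨f, hf⟩ := exists_lieHom_comp_eq (quotHom Γ.relIdeal) (quotHom_surjective _) F
    fun x hx => LieHom.mem_ker.1 (hrel (quotHom_eq_zero.1 hx))
  exact ⟨f, fun y => (hf _).trans (hFW y), fun a => (hf _).trans (hF0 a),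
    fun x => (hf _).trans (hFV x)⟩

variable (Γ)

lemma lie_mem_gradeMax {k l : ℤ} {z z' : Γ.GMax} (hz : z ∈ Γ.gradeMax k)
    (hz' : z' ∈ Γ.gradeMax l) : ⁅z, z'⁆ ∈ Γ.gradeMax (k + l) :=
  Homogeneous.lie hz hz'

lemma gradeMax_eq_degSpan (k : ℤ) : Γ.gradeMax k =
    degSpan (LinearMap.range Γ.maxW) (LinearMap.range Γ.maxZero) (LinearMap.range Γ.maxV) k := by
  apply le_antisymm
  · intro z hz
    change Γ.Homogeneous k z at hz
    induction hz with
    | ofV x => exact ⟨x, rfl⟩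
    | ofZero a => exact ⟨a, rfl⟩
    | ofW y => exact ⟨y, rfl⟩
    | lie _ _ h h' => exact Γ.isLocalHom_max.isLocalTriple.lie_mem_degSpan h h'
    | zero => exact zero_mem _
    | add _ _ h h' => exact add_mem h h'
    | smul c _ h => exact Submodule.smul_mem _ c h
  · refine degSpan_le (fun _ _ _ _ => Γ.lie_mem_gradeMax) ?_ ?_ ?_ k
    · rintro _ ⟨y, rfl⟩
      exact .ofW y
    · rintro _ ⟨a, rfl⟩
      exact .ofZero a
    · rintro _ ⟨x, rfl⟩
      exact .ofV x

lemma iSup_gradeMax : ⨆ k, Γ.gradeMax k = ⊤ := by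
  simp only [gradeMax_eq_degSpan]
  rw [Γ.isLocalHom_max.isLocalTriple.iSup_degSpan]
  set S := LieSubalgebra.lieSpan ℂ Γ.GMax ((LinearMap.range Γ.maxW : Set Γ.GMax) ∪
    LinearMap.range Γ.maxZero ∪ LinearMap.range Γ.maxV)
  have hmem : ∀ i : V ⊕ 𝔤 ⊕ W, quotHom Γ.relIdeal (FreeLieAlgebra.of ℂ i) ∈ S := by
    rintro (x | a | y)
    · exact LieSubalgebra.subset_lieSpan (.inr ⟨x, rfl⟩)
    · exact LieSubalgebra.subset_lieSpan (.inl (.inr ⟨a, rfl⟩))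
    · exact LieSubalgebra.subset_lieSpan (.inl (.inl ⟨y, rfl⟩))
  let F : Γ.Free →ₗ⁅ℂ⁆ S := FreeLieAlgebra.lift ℂ fun i => ⟨_, hmem i⟩
  have hF : S.incl.comp F = quotHom Γ.relIdeal := FreeLieAlgebra.hom_ext fun i => by
    change (F (FreeLieAlgebra.of ℂ i) : Γ.GMax) = _
    rw [FreeLieAlgebra.lift_of_apply]
  refine eq_top_iff.2 fun z _ => ?_
  obtain ⟨x, rfl⟩ := quotHom_surjective Γ.relIdeal z
  rw [← hF]
  exact (F x).2

/-! ### The minimal graded Lie algebra as a quotient -/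

variable {Γ} {𝒢 : ℤ → Submodule ℂ G}

/-- A graded Lie algebra with local part `W ⊕ 𝔤 ⊕ V` is transitive if no nonzero element of degree
at least `2` commutes with `W`, and no nonzero element of degree at most `-2` commutes with `V`. -/
structure IsTransitive (𝒢 : ℤ → Submodule ℂ G) (jW : W →ₗ[ℂ] G) (jV : V →ₗ[ℂ] G) : Prop where
  pos : ∀ n : ℕ, ∀ z ∈ 𝒢 ((n + 2 : ℕ) : ℤ), (∀ y, ⁅jW y, z⁆ = 0) → z = 0
  neg : ∀ n : ℕ, ∀ z ∈ 𝒢 (-((n + 2 : ℕ) : ℤ)), (∀ x, ⁅jV x, z⁆ = 0) → z = 0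

section

variable {f : Γ.GMax →ₗ⁅ℂ⁆ G} (hfW : ∀ y, f (Γ.maxW y) = jW y)
  (hfZero : ∀ a, f (Γ.maxZero a) = jZero a) (hfV : ∀ x, f (Γ.maxV x) = jV x)
include hfW hfZero hfV

lemma map_gradeMax (h : Γ.IsGradedWithLocalPart 𝒢 jW jZero jV) (k : ℤ) :
    (Γ.gradeMax k).map (f : Γ.GMax →ₗ[ℂ] G) = 𝒢 k := by
  rw [h.eq_degSpan, gradeMax_eq_degSpan, map_degSpan, ← LinearMap.range_comp,
    ← LinearMap.range_comp, ← LinearMap.range_comp]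
  congr 2
  · exact LinearMap.ext hfW
  · exact LinearMap.ext hfZero
  · exact LinearMap.ext hfV

lemma surjective_of_isGradedWithLocalPart (h : Γ.IsGradedWithLocalPart 𝒢 jW jZero jV) :
    Function.Surjective f := by
  have : LinearMap.range (f : Γ.GMax →ₗ[ℂ] G) = ⊤ := by
    rw [LinearMap.range_eq_map, ← iSup_gradeMax, Submodule.map_iSup, ← h.iSup_eq_top]
    exact iSup_congr (map_gradeMax hfW hfZero hfV h)
  exact LinearMap.range_eq_top.1 this

/-- The kernel of `g_max(Γ) → G` is a graded ideal which meets the local part trivially, because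
the local part of `G` is a copy of `Γ` in independent degrees. -/
lemma ker_le_maxIdeal (h : Γ.IsGradedWithLocalPart 𝒢 jW jZero jV) : f.ker ≤ Γ.maxIdeal := by
  have hmap : ∀ k, ∀ z ∈ Γ.gradeMax k, f z ∈ 𝒢 k := fun k z hz =>
    map_gradeMax hfW hfZero hfV h k ▸ ⟨z, hz, rfl⟩
  refine le_sSup ⟨isGradedIdeal_ker Γ.iSup_gradeMax h.iSupIndep f hmap, ?_⟩
  refine (Submodule.eq_bot_iff _).2 ?_
  rintro z ⟨hz, hz'⟩
  obtain ⟨z', hz'', v, hv, rfl⟩ := Submodule.mem_sup.1 hz'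
  obtain ⟨w, hw, a, ha, rfl⟩ := Submodule.mem_sup.1 hz''
  rw [gradeMax_eq_degSpan] at hw ha hv
  obtain ⟨y, rfl⟩ := hw
  obtain ⟨a, rfl⟩ := ha
  obtain ⟨x, rfl⟩ := hv
  have hz0 : jW y + jZero a + jV x = 0 := by
    rw [← hfW, ← hfZero, ← hfV, ← map_add, ← map_add]
    exact LieHom.mem_ker.1 hz
  have hW : jW y ∈ 𝒢 (-1) := h.range_W ▸ ⟨y, rfl⟩
  have hZ : jZero a ∈ 𝒢 0 := h.range_zero ▸ ⟨a, rfl⟩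
  have hV : jV x ∈ 𝒢 1 := h.range_V ▸ ⟨x, rfl⟩
  let c : ℤ → G := fun k => if k = -1 then jW y else if k = 0 then jZero a else jV x
  have hc := (iSupIndep_iff_finsetSum_eq_zero_imp_eq_zero 𝒢).1 h.iSupIndep {-1, 0, 1} c
    (by simp [c, hW, hZ, hV]) (by simp [c, ← add_assoc, hz0])
  have h1 : jW y = 0 := by simpa [c] using hc (-1) (by simp)
  have h2 : jZero a = 0 := by simpa [c] using hc 0 (by simp)
  have h3 : jV x = 0 := by simpa [c] using hc 1 (by simp)
  rw [(map_eq_zero_iff jW h.injective_W).1 h1, (map_eq_zero_iff jZero h.injective_zero).1 h2,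
    (map_eq_zero_iff jV h.injective_V).1 h3]
  simp

/-- If `G` is transitive, then a graded ideal `I` of `g_max(Γ)` which meets the local part trivially
is killed by `g_max(Γ) → G`. This is proved by induction on the degree: bracketing an element of
`I` of degree at least `2` with `W` gives elements of `I` of smaller degree. -/
lemma maxIdeal_le_ker (h : Γ.IsGradedWithLocalPart 𝒢 jW jZero jV) (ht : IsTransitive 𝒢 jW jV) :
    Γ.maxIdeal ≤ f.ker := by
  have hmap : ∀ k, ∀ z ∈ Γ.gradeMax k, f z ∈ 𝒢 k := fun k z hz =>
    map_gradeMax hfW hfZero hfV h k ▸ ⟨z, hz, rfl⟩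
  have hW : ∀ y, Γ.maxW y ∈ Γ.gradeMax (-1) := .ofW
  have hV : ∀ x, Γ.maxV x ∈ Γ.gradeMax 1 := .ofV
  refine sSup_le ?_
  rintro I ⟨hI, hloc⟩
  have hbot : ∀ z ∈ I, z ∈ Γ.gradeMax (-1) ⊔ Γ.gradeMax 0 ⊔ Γ.gradeMax 1 → z = 0 := fun z hz hz' =>
    (Submodule.eq_bot_iff _).1 hloc z ⟨hz, hz'⟩
  have hpos : ∀ n : ℕ, ∀ z ∈ I, z ∈ Γ.gradeMax ((n + 1 : ℕ) : ℤ) → f z = 0 := by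
    intro n
    induction n with
    | zero =>
      intro z hz hz'
      rw [hbot z hz (Submodule.mem_sup_right hz'), map_zero]
    | succ n ih =>
      intro z hz hz'
      refine ht.pos n _ (hmap _ z hz') fun y => ?_
      rw [← hfW, ← LieHom.map_lie]
      refine ih _ (I.lie_mem hz) ?_
      convert Γ.lie_mem_gradeMax (hW y) hz' using 2
      push_cast; ring
  have hneg : ∀ n : ℕ, ∀ z ∈ I, z ∈ Γ.gradeMax (-((n + 1 : ℕ) : ℤ)) → f z = 0 := by
    intro n
    induction n with
    | zero =>
      intro z hz hz'
      rw [hbot z hz (Submodule.mem_sup_left (Submodule.mem_sup_left hz')), map_zero]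
    | succ n ih =>
      intro z hz hz'
      refine ht.neg n _ (hmap _ z hz') fun x => ?_
      rw [← hfV, ← LieHom.map_lie]
      refine ih _ (I.lie_mem hz) ?_
      convert Γ.lie_mem_gradeMax (hV x) hz' using 2
      push_cast; ring
  change I.toSubmodule ≤ f.ker.toSubmodule
  rw [hI]
  refine iSup_le ?_
  rintro ((_ | n) | n) z ⟨hz, hz'⟩ <;> refine LieHom.mem_ker.2 ?_
  · rw [hbot z hz (Submodule.mem_sup_left (Submodule.mem_sup_right hz')), map_zero]
  · exact hpos n z hz hz'
  · exact hneg n z hz hz'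

end

lemma isLocalHom_min (Γ : LocalLieAlgebra 𝔤 V W) : Γ.IsLocalHom Γ.minW Γ.minZero Γ.minV :=
  Γ.isLocalHom_max.comp (quotHom Γ.maxIdeal)

lemma gradeMin_eq_degSpan (Γ : LocalLieAlgebra 𝔤 V W) : Γ.gradeMin =
    degSpan (LinearMap.range Γ.minW) (LinearMap.range Γ.minZero) (LinearMap.range Γ.minV) := by
  funext k
  change (Γ.gradeMax k).map (quotHom Γ.maxIdeal : Γ.GMax →ₗ[ℂ] Γ.GMin) = _
  rw [gradeMax_eq_degSpan, map_degSpan, ← LinearMap.range_comp, ← LinearMap.range_comp,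
    ← LinearMap.range_comp]
  rfl

namespace IsGradedWithLocalPart

/-- Every graded Lie algebra with local part `Γ` has `g_min(Γ)` as a quotient, and it is isomorphic
to `g_min(Γ)` if it is transitive. -/
lemma exists_toMin (h : Γ.IsGradedWithLocalPart 𝒢 jW jZero jV) :
    ∃ f : G →ₗ⁅ℂ⁆ Γ.GMin, Function.Surjective f ∧
      (∀ k, (𝒢 k).map (f : G →ₗ[ℂ] Γ.GMin) = Γ.gradeMin k) ∧
      ((∀ y, f (jW y) = Γ.minW y) ∧ (∀ a, f (jZero a) = Γ.minZero a) ∧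
        ∀ x, f (jV x) = Γ.minV x) ∧
      (IsTransitive 𝒢 jW jV → Function.Injective f) := by
  obtain ⟨F, hFW, hF0, hFV⟩ := h.isLocalHom.exists_lift
  have hF := surjective_of_isGradedWithLocalPart hFW hF0 hFV h
  obtain ⟨f, hf⟩ := exists_lieHom_comp_eq F hF (quotHom Γ.maxIdeal) fun z hz =>
    quotHom_eq_zero.2 (ker_le_maxIdeal hFW hF0 hFV h (LieHom.mem_ker.2 hz))
  refine ⟨f, fun z => ?_, fun k => ?_, ⟨fun y => ?_, fun a => ?_, fun x => ?_⟩, fun ht => ?_⟩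
  · obtain ⟨z, rfl⟩ := quotHom_surjective _ z
    exact ⟨F z, hf z⟩
  · rw [← map_gradeMax hFW hF0 hFV h, ← Submodule.map_comp]
    exact congrArg (fun g => (Γ.gradeMax k).map g) (LinearMap.ext hf)
  · rw [← hFW, hf]; rfl
  · rw [← hF0, hf]; rfl
  · rw [← hFV, hf]; rfl
  · refine (injective_iff_map_eq_zero f).2 fun z hz => ?_
    obtain ⟨z, rfl⟩ := hF z
    rw [hf, quotHom_eq_zero] at hz
    exact LieHom.mem_ker.1 (maxIdeal_le_ker hFW hF0 hFV h ht hz)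

/-- A graded Lie algebra with local part `Γ` which is transitive is isomorphic to `g_min(Γ)`. -/
lemma exists_equiv_min (h : Γ.IsGradedWithLocalPart 𝒢 jW jZero jV) (ht : IsTransitive 𝒢 jW jV) :
    ∃ e : G ≃ₗ⁅ℂ⁆ Γ.GMin, ∀ k, (𝒢 k).map (e : G →ₗ[ℂ] Γ.GMin) = Γ.gradeMin k := by
  obtain ⟨f, hsurj, hgrade, -, hinj⟩ := h.exists_toMin
  exact ⟨LieEquiv.ofBijective f ⟨hinj ht, hsurj⟩, hgrade⟩

/-- The existence of a transitive graded Lie algebra with local part `Γ` implies that the local part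
of `g_min(Γ)` is `Γ`, and that `g_min(Γ)` is the direct sum of its components. -/
lemma isGradedWithLocalPart_min (h : Γ.IsGradedWithLocalPart 𝒢 jW jZero jV)
    (ht : IsTransitive 𝒢 jW jV) :
    Γ.IsGradedWithLocalPart Γ.gradeMin Γ.minW Γ.minZero Γ.minV := by
  obtain ⟨f, hsurj, hgrade, ⟨hW, hZero, hV⟩, hinj⟩ := h.exists_toMin
  have hinj := hinj ht
  have hind : _root_.iSupIndep Γ.gradeMin := by
    rw [show Γ.gradeMin = _ from funext fun k => (hgrade k).symm]
    exact LinearMap.iSupIndep_map (f : G →ₗ[ℂ] Γ.GMin) hinj h.iSupIndep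
  have htop : ⨆ k, Γ.gradeMin k = ⊤ := by
    simp only [← hgrade]
    rw [← Submodule.map_iSup, h.iSup_eq_top, ← LinearMap.range_eq_map]
    exact LinearMap.range_eq_top.2 hsurj
  rw [gradeMin_eq_degSpan] at hind htop ⊢
  refine isGradedWithLocalPart_degSpan Γ.isLocalHom_min ?_ ?_ ?_ hind htop
  · exact (funext hW : f ∘ jW = Γ.minW) ▸ hinj.comp h.injective_W
  · exact (funext hZero : f ∘ jZero = Γ.minZero) ▸ hinj.comp h.injective_zero
  · exact (funext hV : f ∘ jV = Γ.minV) ▸ hinj.comp h.injective_V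

lemma isMinimal_min (h : Γ.IsGradedWithLocalPart 𝒢 jW jZero jV) (ht : IsTransitive 𝒢 jW jV) :
    IsMinimal.{u, v, w} Γ Γ.gradeMin Γ.minW Γ.minZero Γ.minV := by
  refine ⟨h.isGradedWithLocalPart_min ht, fun G' _ _ 𝒢' jW' jZero' jV' h' => ?_⟩
  obtain ⟨f, hsurj, hgrade, hloc, -⟩ := h'.exists_toMin
  exact ⟨f, hsurj, hgrade, hloc⟩

end IsGradedWithLocalPart

/-! ### The Lie algebra constructed inductively -/

variable (Γ)

/-- The map `V → ⨁ U_k`. -/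
def algV : V →ₗ[ℂ] Γ.Alg where
  toFun x := ⟨Γ.inV x, (IsAd.baseV x).mem_total⟩
  map_add' x x' := Subtype.ext (Γ.inV.map_add x x')
  map_smul' c x := Subtype.ext (Γ.inV.map_smul c x)

/-- The map `𝔤 → ⨁ U_k`. -/
def algZero : 𝔤 →ₗ[ℂ] Γ.Alg where
  toFun a := ⟨Γ.inZero a, (IsAd.baseZero a).mem_total⟩
  map_add' a b := Subtype.ext (Γ.inZero.map_add a b)
  map_smul' c a := Subtype.ext (Γ.inZero.map_smul c a)

/-- The map `W → ⨁ U_k`. -/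
def algW : W →ₗ[ℂ] Γ.Alg where
  toFun y := ⟨Γ.inW y, (IsAd.baseW y).mem_total⟩
  map_add' y y' := Subtype.ext (Γ.inW.map_add y y')
  map_smul' c y := Subtype.ext (Γ.inW.map_smul c y)

lemma algV_lie_val (x : V) (z : Γ.Alg) : (⁅Γ.algV x, z⁆ : Γ.Alg).1 = Γ.opV x z.1 :=
  Γ.lie_val _ _ (.baseV x)

lemma algZero_lie_val (a : 𝔤) (z : Γ.Alg) : (⁅Γ.algZero a, z⁆ : Γ.Alg).1 = Γ.opZero a z.1 :=
  Γ.lie_val _ _ (.baseZero a)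

lemma algW_lie_val (y : W) (z : Γ.Alg) : (⁅Γ.algW y, z⁆ : Γ.Alg).1 = Γ.opW y z.1 :=
  Γ.lie_val _ _ (.baseW y)

lemma isLocalHom_alg : Γ.IsLocalHom Γ.algW Γ.algZero Γ.algV where
  map_zero_zero a b := Subtype.ext <| by
    rw [algZero_lie_val]; exact (Γ.opZero_inZero a b).symm
  map_zero_V a x := Subtype.ext <| by
    rw [algZero_lie_val]; exact (Γ.opZero_inV a x).symm
  map_zero_W a y := Subtype.ext <| by
    rw [algZero_lie_val]; exact (Γ.opZero_inW a y).symm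
  map_V_W x y := Subtype.ext <| by
    rw [algV_lie_val]; exact (Γ.opV_inW x y).symm

lemma inV_injective : Function.Injective Γ.inV := fun _ _ h =>
  congrArg (fun z : Γ.Ambient => (show V from z.2.2 0)) h

lemma inW_injective : Function.Injective Γ.inW := fun _ _ h =>
  congrArg (fun z : Γ.Ambient => (show W from z.1 0)) h

lemma inZero_injective : Function.Injective Γ.inZero := fun _ _ h =>
  congrArg (fun z : Γ.Ambient => z.2.1) h

/-- The inclusion of `⨁ U_k` into the ambient product. -/
def algIncl : Γ.Alg →ₗ[ℂ] Γ.Ambient where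
  toFun z := z.1
  map_add' _ _ := rfl
  map_smul' _ _ := rfl

lemma algIncl_injective : Function.Injective Γ.algIncl := Subtype.val_injective

lemma map_iterLie_algV (n : ℕ) : (iterLie (LinearMap.range Γ.algV) n).map Γ.algIncl =
    (Γ.component n).map (Γ.inPos n) := by
  induction n with
  | zero =>
    change (LinearMap.range Γ.algV).map Γ.algIncl = (⊤ : Submodule ℂ V).map Γ.inV
    rw [← LinearMap.range_comp, ← LinearMap.range_eq_map]
    rfl
  | succ n ih =>
    apply le_antisymm
    · refine Submodule.map_le_iff_le_comap.2 (iterLie_succ_le ?_)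
      rintro _ ⟨x, rfl⟩ z hz
      obtain ⟨u, hu, hz⟩ : Γ.algIncl z ∈ (Γ.component n).map (Γ.inPos n) := ih ▸ ⟨z, hz, rfl⟩
      refine ⟨Γ.raise n x u, Submodule.subset_span ⟨x, u, hu, rfl⟩, ?_⟩
      rw [← opV_inPos, hz]
      exact (Γ.algV_lie_val x z).symm
    · refine Submodule.map_le_iff_le_comap.2 (Submodule.span_le.2 ?_)
      rintro _ ⟨x, u, hu, rfl⟩
      obtain ⟨z, hz, hzu⟩ : Γ.inPos n u ∈ (iterLie (LinearMap.range Γ.algV) n).map Γ.algIncl :=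
        ih ▸ ⟨u, hu, rfl⟩
      refine ⟨⁅Γ.algV x, z⁆, lie_mem_iterLie ⟨x, rfl⟩ hz, ?_⟩
      rw [← opV_inPos, ← hzu]
      exact Γ.algV_lie_val x z

lemma map_iterLie_algW (n : ℕ) : (iterLie (LinearMap.range Γ.algW) n).map Γ.algIncl =
    (Γ.opp.component n).map (Γ.inNeg n) := by
  induction n with
  | zero =>
    change (LinearMap.range Γ.algW).map Γ.algIncl = (⊤ : Submodule ℂ W).map Γ.inW
    rw [← LinearMap.range_comp, ← LinearMap.range_eq_map]
    rfl
  | succ n ih =>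
    apply le_antisymm
    · refine Submodule.map_le_iff_le_comap.2 (iterLie_succ_le ?_)
      rintro _ ⟨y, rfl⟩ z hz
      obtain ⟨u, hu, hz⟩ : Γ.algIncl z ∈ (Γ.opp.component n).map (Γ.inNeg n) := ih ▸ ⟨z, hz, rfl⟩
      refine ⟨Γ.opp.raise n y u, Submodule.subset_span ⟨y, u, hu, rfl⟩, ?_⟩
      rw [← opW_inNeg, hz]
      exact (Γ.algW_lie_val y z).symm
    · refine Submodule.map_le_iff_le_comap.2 (Submodule.span_le.2 ?_)
      rintro _ ⟨y, u, hu, rfl⟩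
      obtain ⟨z, hz, hzu⟩ : Γ.inNeg n u ∈ (iterLie (LinearMap.range Γ.algW) n).map Γ.algIncl :=
        ih ▸ ⟨u, hu, rfl⟩
      refine ⟨⁅Γ.algW y, z⁆, lie_mem_iterLie ⟨y, rfl⟩ hz, ?_⟩
      rw [← opW_inNeg, ← hzu]
      exact Γ.algW_lie_val y z

lemma map_grade (k : ℤ) : (Γ.grade k).map Γ.algIncl = Γ.piece k := by
  refine le_antisymm (Submodule.map_le_iff_le_comap.2 fun z hz => hz) fun z hz => ?_
  exact ⟨⟨z, Submodule.mem_iSup_of_mem k hz⟩, hz, rfl⟩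

lemma grade_eq_degSpan : Γ.grade =
    degSpan (LinearMap.range Γ.algW) (LinearMap.range Γ.algZero) (LinearMap.range Γ.algV) := by
  funext k
  refine Submodule.map_injective_of_injective Γ.algIncl_injective ?_
  rw [map_grade]
  obtain (_ | n) | n := k
  · exact LinearMap.range_comp Γ.algZero Γ.algIncl
  · exact (Γ.map_iterLie_algV n).symm
  · exact (Γ.map_iterLie_algW n).symm

/-- The projection of the ambient product onto its component of degree `k`. -/
def degProj : ℤ → Γ.Ambient →ₗ[ℂ] Γ.Ambient
  | Int.ofNat 0 => Γ.inZero ∘ₗ LinearMap.fst ℂ 𝔤 (∀ n, Tower 𝔤 V W n) ∘ₗ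
      LinearMap.snd ℂ (∀ n, Tower 𝔤 W V n) (𝔤 × ∀ n, Tower 𝔤 V W n)
  | Int.ofNat (n + 1) => Γ.inPos n ∘ₗ LinearMap.proj (φ := fun n => Tower 𝔤 V W n) n ∘ₗ
      LinearMap.snd ℂ 𝔤 (∀ n, Tower 𝔤 V W n) ∘ₗ
        LinearMap.snd ℂ (∀ n, Tower 𝔤 W V n) (𝔤 × ∀ n, Tower 𝔤 V W n)
  | Int.negSucc n => Γ.inNeg n ∘ₗ LinearMap.proj (φ := fun n => Tower 𝔤 W V n) n ∘ₗ
      LinearMap.fst ℂ (∀ n, Tower 𝔤 W V n) (𝔤 × ∀ n, Tower 𝔤 V W n)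

lemma degProj_of_mem_piece {k : ℤ} {z : Γ.Ambient} (hz : z ∈ Γ.piece k) :
    Γ.degProj k z = z := by
  obtain (_ | n) | n := k
  · obtain ⟨a, rfl⟩ := hz
    rfl
  · obtain ⟨u, -, rfl⟩ := hz
    simp [degProj]
  · obtain ⟨u, -, rfl⟩ := hz
    simp [degProj]

lemma degProj_of_mem_piece_of_ne {k l : ℤ} (hkl : l ≠ k) {z : Γ.Ambient} (hz : z ∈ Γ.piece l) :
    Γ.degProj k z = 0 := by
  obtain (_ | n) | n := k <;> obtain (_ | m) | m := l <;> obtain ⟨u, hu⟩ := hz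
  · exact absurd rfl hkl
  · obtain ⟨-, rfl⟩ := hu
    simp [degProj]
  · obtain ⟨-, rfl⟩ := hu
    simp [degProj]
  · subst hu
    simp [degProj]
  · obtain ⟨-, rfl⟩ := hu
    have : n ≠ m := fun h => hkl (by rw [h])
    simp [degProj, Pi.single_eq_of_ne this]
  · obtain ⟨-, rfl⟩ := hu
    simp [degProj]
  · subst hu
    simp [degProj]
  · obtain ⟨-, rfl⟩ := hu
    simp [degProj]
  · obtain ⟨-, rfl⟩ := hu
    have : n ≠ m := fun h => hkl (by rw [h])
    simp [degProj, Pi.single_eq_of_ne this]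

lemma iSupIndep_grade : iSupIndep Γ.grade := by
  intro k
  rw [Submodule.disjoint_def]
  intro z hz hz'
  have hle : ⨆ (l) (_ : l ≠ k), Γ.grade l ≤ LinearMap.ker (Γ.degProj k ∘ₗ Γ.algIncl) :=
    iSup₂_le fun l hl z hz => Γ.degProj_of_mem_piece_of_ne hl hz
  refine Γ.algIncl_injective ?_
  rw [map_zero]
  exact (Γ.degProj_of_mem_piece hz).symm.trans (hle hz')

lemma iSup_grade : ⨆ k, Γ.grade k = ⊤ := by
  refine eq_top_iff.2 fun z _ => ?_
  have hz : Γ.algIncl z ∈ ⨆ k, Γ.piece k := z.2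
  simp only [← map_grade] at hz
  rw [← Submodule.map_iSup] at hz
  obtain ⟨z', hz', h⟩ := hz
  exact Γ.algIncl_injective h ▸ hz'

lemma isGradedWithLocalPart_alg :
    Γ.IsGradedWithLocalPart Γ.grade Γ.algW Γ.algZero Γ.algV := by
  have hind := Γ.iSupIndep_grade
  have htop := Γ.iSup_grade
  rw [grade_eq_degSpan] at hind htop ⊢
  exact isGradedWithLocalPart_degSpan Γ.isLocalHom_alg
    (fun _ _ h => Γ.inW_injective (congrArg Γ.algIncl h))
    (fun _ _ h => Γ.inZero_injective (congrArg Γ.algIncl h))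
    (fun _ _ h => Γ.inV_injective (congrArg Γ.algIncl h)) hind htop

/-- `⨁ U_k` is transitive, because an element of degree `n + 1 ≥ 2` *is* a linear map from `W` to
the component of degree `n`, namely the bracket with the elements of `W`. -/
lemma isTransitive_alg : IsTransitive Γ.grade Γ.algW Γ.algV where
  pos n z hz h := by
    obtain ⟨u, -, hu⟩ : z.1 ∈ (Γ.component (n + 1)).map (Γ.inPos (n + 1)) := hz
    refine Γ.algIncl_injective (Γ.posAction.faithful n z.1 ⟨u, hu⟩ fun y => ?_)
    exact (Γ.algW_lie_val y z).symm.trans (congrArg Γ.algIncl (h y))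
  neg n z hz h := by
    obtain ⟨u, -, hu⟩ : z.1 ∈ (Γ.opp.component (n + 1)).map (Γ.inNeg (n + 1)) := hz
    refine Γ.algIncl_injective (Γ.negAction.faithful n z.1 ⟨u, hu⟩ fun x => ?_)
    exact (Γ.algV_lie_val x z).symm.trans (congrArg Γ.algIncl (h x))

end SasanoPentad.LocalLieAlgebra

namespace SasanoPentad

/-! ### Standard pentads -/

/-- The brackets of the two local Lie algebras agree, since both are determined by `B`. -/
lemma IsStandardPentad.localPart_bracket_eq {𝔤 : Type u} {U : Type v} [LieRing 𝔤] [LieAlgebra ℂ 𝔤]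
    [FiniteDimensional ℂ 𝔤] [AddCommGroup U] [Module ℂ U] [LieRingModule 𝔤 U] [LieModule ℂ 𝔤 U]
    {𝒰 : LieSubmodule ℂ 𝔤 (Module.Dual ℂ U)} {B : LinearMap.BilinForm ℂ 𝔤} (hB : B.IsSymm)
    (P : IsStandardPentad 𝒰 B) (v : U) (φ : 𝒰) :
    P.localPart.bracket v φ = (P.Gamma hB).bracket v φ := by
  rw [← sub_eq_zero]
  refine P.nondegenerate.2 _ fun a => ?_
  rw [map_sub, sub_eq_zero]
  refine (P.form_phi a v φ).trans ?_
  rw [hB.eq a]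
  simp [fundamental, LinearMap.BilinForm.apply_toDual_symm_apply]

end SasanoPentad

theorem mainTheorem2 {𝔤 : Type u} {U : Type v} [LieRing 𝔤] [LieAlgebra ℂ 𝔤]
    [FiniteDimensional ℂ 𝔤] [AddCommGroup U] [Module ℂ U] [FiniteDimensional ℂ U]
    [LieRingModule 𝔤 U] [LieModule ℂ 𝔤 U] (B : LinearMap.BilinForm ℂ 𝔤) (hB : B.IsSymm)
    (P : SasanoPentad.IsStandardPentad (⊤ : LieSubmodule ℂ 𝔤 (Module.Dual ℂ U)) B) :
    (∃ e : P.L ≃ₗ⁅ℂ⁆ (P.Gamma hB).GMin,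
        ∀ k : ℤ, (P.grade k).map (e : P.L →ₗ[ℂ] (P.Gamma hB).GMin) = (P.Gamma hB).gradeMin k) ∧
      SasanoPentad.LocalLieAlgebra.IsMinimal.{u, v, w} (P.Gamma hB) (P.Gamma hB).gradeMin
        (P.Gamma hB).minW (P.Gamma hB).minZero (P.Gamma hB).minV := by
  -- `P.L` is built from the local Lie algebra with `⊤` in degree `-1`, and `P.Gamma hB` has the
  -- dual space itself there.
  let ε : Module.Dual ℂ U ≃ₗ⁅ℂ,𝔤⁆ (⊤ : LieSubmodule ℂ 𝔤 (Module.Dual ℂ U)) :=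
    (LieModuleEquiv.ofTop ℂ 𝔤 (Module.Dual ℂ U)).symm
  have h := P.localPart.isGradedWithLocalPart_alg.congr_W (Γ' := P.Gamma hB) ε
    fun v φ => P.localPart_bracket_eq hB v (ε φ)
  have ht : SasanoPentad.LocalLieAlgebra.IsTransitive P.grade
      (P.localPart.algW ∘ₗ (ε : Module.Dual ℂ U →ₗ[ℂ] _)) P.localPart.algV :=
    { pos := fun n z hz hy => P.localPart.isTransitive_alg.pos n z hz fun y => hy (ε.symm y)
      neg := P.localPart.isTransitive_alg.neg }
  exact ⟨h.exists_equiv_min ht, h.isMinimal_min ht⟩
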